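/- Let $d\in\mathbb N$ and $1\le p\le\infty$, and let $W^{\infty,p}(\mathbb R^d,\mathbb R^d)$ be the Fréchet space of all $f\in C^\infty(\mathbb R^d,\mathbb R^d)$ with $\|f^{(k)}\|_{L^p}<\infty$ for all $k\in\mathbb N$, topologized by the seminorms $f\mapsto\|f^{(k)}\|_{L^p}$, where $f^{(k)}$ is the $k$-th Fréchet derivative. Let $L^1([0,1],W^{\infty,p}(\mathbb R^d,\mathbb R^d))$ be the space of functions $u:[0,1]\to W^{\infty,p}(\mathbb R^d,\mathbb R^d)$ that are integrable by seminorm, modulo those $u$ with $\int_0^1 q(u(t))\,dt=0$ for every continuous seminorm $q$, with the topology given by the seminorms $u\mapsto\int_0^1 q(u(t))\,dt$. Here $u$ is integrable by seminorm if for every continuous seminorm $q$ there are simple functions $u^q_n$ with $q(u^q_n(t)-u(t))\to0$ for almost every $t$ and $q\circ(u^q_n-u)\in L^1([0,1])$ for all $n$, and if for every measurable $J\subseteq[0,1]$ there is a vector $F_J$ with $q\big(F_J-\int_J u^q_n(t)\,dt\big)\to0$ for all $q$. For every such $u$ and every $x\in\mathbb R^d$ the equation $$y(t)=x+\int_0^t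 u(s,y(s))\,ds,\qquad t\in[0,1],$$ has exactly one continuous solution $y=:\Phi_u(\cdot,x)$ (with $s\mapsto u(s,y(s))$ Lebesgue integrable). It depends only on the class of $u$. Put $\varphi_u(t,x):=\Phi_u(t,x)-x$. Then $\varphi_u(t,\cdot)\in W^{\infty,p}(\mathbb R^d,\mathbb R^d)$ for all $t\in[0,1]$, the curve $t\mapsto\varphi_u(t,\cdot)$ is continuous into $W^{\infty,p}(\mathbb R^d,\mathbb R^d)$, and the mapping $$L^1([0,1],W^{\infty,p}(\mathbb R^d,\mathbb R^d))\ni u\mapsto\varphi_u\in C([0,1],W^{\infty,p}(\mathbb R^d,\mathbb R^d))$$ is continuous, where $C([0,1],\cdot)$ carries the topology of uniform convergence. -/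

import Mathlib

open MeasureTheory Filter Topology
open scoped ENNReal ContDiff unitInterval

/-! ### Integrability by seminorm on the unit interval -/

section IntegrabilityBySeminorm

variable {E : Type*} [AddCommGroup E] [Module ℝ E]

/-- The integral of a simple function over a set `J ⊆ [0,1]`:
the sum over all values `y` of `λ(s⁻¹{y} ∩ J) • y`. -/
noncomputable def simpleIntegral (s : SimpleFunc I E) (J : Set I) : E :=
  ∑ y ∈ s.range, (volume.real (s ⁻¹' {y} ∩ J)) • y

/-- The simple functions `s n` converge to `f` with respect to the seminorm `q`, almost everywhere
on `[0,1]`. -/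
def ApproxBySeminorm (q : Seminorm ℝ E) (s : ℕ → SimpleFunc I E) (f : I → E) : Prop :=
  ∀ᵐ t : I, Tendsto (fun n => q (s n t - f t)) atTop (𝓝 0)

/-- `f : [0,1] → E` is integrable by seminorm: for every continuous seminorm `q` there is a
sequence `s q n` of simple functions (depending on `q`) converging to `f` almost everywhere with
respect to `q` (that is, `f` is measurable by seminorm), such that all `q ∘ (s q n - f)` are
integrable, and such that for every measurable `J` there is one vector `F` in `E` (the integral of
`f` over `J`) to which the integrals of `s q n` over `J` converge with respect to `q`, for every
continuous seminorm `q`. -/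
def IntegrableBySeminorm [TopologicalSpace E] (f : I → E) : Prop :=
  ∃ s : Seminorm ℝ E → ℕ → SimpleFunc I E,
    (∀ q : Seminorm ℝ E, Continuous q → ApproxBySeminorm q (s q) f ∧
      ∀ n, Integrable (fun t => q (s q n t - f t)) volume) ∧
    ∀ J : Set I, MeasurableSet J → ∃ F : E, ∀ q : Seminorm ℝ E, Continuous q →
      Tendsto (fun n => q (F - simpleIntegral (s q n) J)) atTop (𝓝 0)

/-! Helper facts: the functions integrable by seminorm form a vector space on which
`f ↦ ∫ q (f t) dt` is a seminorm. -/

theorem simpleIntegral_map {β : Type*} (r : SimpleFunc I β) (g : β → E) {J : Set I}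
    (hJ : MeasurableSet J) :
    simpleIntegral (r.map g) J = ∑ b ∈ r.range, (volume.real (r ⁻¹' {b} ∩ J)) • g b := by
  classical
  unfold simpleIntegral
  rw [SimpleFunc.range_map]
  rw [← Finset.sum_fiberwise_of_maps_to (s := r.range) (t := r.range.image g) (g := g)
    (fun b hb => Finset.mem_image_of_mem g hb)]
  refine Finset.sum_congr rfl fun y _ => ?_
  have h1 : ((r.map g) ⁻¹' {y} ∩ J) =
      ⋃ b ∈ (r.range.filter fun b => g b = y), (r ⁻¹' {b} ∩ J) := by
    ext t
    simp only [SimpleFunc.coe_map, Set.mem_inter_iff, Set.mem_preimage, Function.comp_apply,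
      Set.mem_singleton_iff, Finset.mem_filter, Set.mem_iUnion, exists_prop]
    constructor
    · rintro ⟨h, h'⟩
      exact ⟨r t, ⟨SimpleFunc.mem_range_self r t, h⟩, rfl, h'⟩
    · rintro ⟨b, ⟨-, h⟩, h', h''⟩
      exact ⟨h' ▸ h, h''⟩
  rw [h1, measureReal_biUnion_finset, Finset.sum_smul]
  · refine Finset.sum_congr rfl fun b hb => ?_
    rw [(Finset.mem_filter.1 hb).2]
  · intro b _ b' _ hbb'
    refine Set.disjoint_left.2 ?_
    rintro t ⟨h, _⟩ ⟨h', _⟩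
    exact hbb' (h.symm.trans h')
  · intro b _
    exact (r.measurableSet_fiber b).inter hJ

theorem simpleIntegral_add (s r : SimpleFunc I E) {J : Set I} (hJ : MeasurableSet J) :
    simpleIntegral (s + r) J = simpleIntegral s J + simpleIntegral r J := by
  have h1 : s + r = (s.pair r).map (fun z : E × E => z.1 + z.2) := rfl
  have h2 : simpleIntegral s J = simpleIntegral ((s.pair r).map Prod.fst) J := rfl
  have h3 : simpleIntegral r J = simpleIntegral ((s.pair r).map Prod.snd) J := rfl
  rw [h1, h2, h3, simpleIntegral_map _ _ hJ, simpleIntegral_map _ _ hJ,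
    simpleIntegral_map _ _ hJ, ← Finset.sum_add_distrib]
  simp only [smul_add]

theorem simpleIntegral_smul (c : ℝ) (s : SimpleFunc I E) {J : Set I} (hJ : MeasurableSet J) :
    simpleIntegral (s.map (fun y => c • y)) J = c • simpleIntegral s J := by
  rw [simpleIntegral_map _ _ hJ]
  unfold simpleIntegral
  rw [Finset.smul_sum]
  exact Finset.sum_congr rfl fun y _ => smul_comm _ _ _

theorem simpleIntegral_zero (J : Set I) : simpleIntegral (0 : SimpleFunc I E) J = 0 := by
  unfold simpleIntegral
  refine Finset.sum_eq_zero fun y hy => ?_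
  obtain ⟨t, rfl⟩ := SimpleFunc.mem_range.1 hy
  simp

theorem ApproxBySeminorm.aestronglyMeasurable {q : Seminorm ℝ E} {s : ℕ → SimpleFunc I E}
    {f : I → E} (h : ApproxBySeminorm q s f) (r : SimpleFunc I E) :
    AEStronglyMeasurable (fun t => q (r t - f t)) volume := by
  refine aestronglyMeasurable_of_tendsto_ae (u := atTop)
    (f := fun n t => q (r t - s n t)) ?_ ?_
  · intro n
    exact (((r.pair (s n)).map fun z : E × E => q (z.1 - z.2)).stronglyMeasurable
      ).aestronglyMeasurable
  · filter_upwards [h] with t ht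
    rw [tendsto_iff_dist_tendsto_zero]
    refine squeeze_zero (fun _ => dist_nonneg) (fun n => ?_) ht
    rw [Real.dist_eq]
    refine (abs_sub_map_le_sub q _ _).trans ?_
    rw [show r t - s n t - (r t - f t) = -(s n t - f t) by abel, map_neg_eq_map]

namespace IntegrableBySeminorm

variable [TopologicalSpace E] {f g : I → E}

theorem integrable_seminorm (hf : IntegrableBySeminorm f) {q : Seminorm ℝ E}
    (hq : Continuous q) : Integrable (fun t => q (f t)) volume := by
  obtain ⟨s, h, -⟩ := hf
  obtain ⟨h1, h2⟩ := h q hq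
  have h3 : Integrable (fun t => q (s q 0 t)) volume :=
    SimpleFunc.integrable_of_isFiniteMeasure ((s q 0).map q)
  refine (h3.add (h2 0)).mono' ?_ (Eventually.of_forall fun t => ?_)
  · simpa using h1.aestronglyMeasurable 0
  · rw [Real.norm_of_nonneg (apply_nonneg q _)]
    have : f t = s q 0 t - (s q 0 t - f t) := by abel
    calc q (f t) = q (s q 0 t - (s q 0 t - f t)) := by rw [← this]
      _ ≤ q (s q 0 t) + q (s q 0 t - f t) := map_sub_le_add q _ _

theorem zero : IntegrableBySeminorm (0 : I → E) := by
  refine ⟨fun _ _ => 0, fun q _ => ⟨?_, fun n => ?_⟩, fun J _ => ⟨0, fun q _ => ?_⟩⟩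
  · exact Eventually.of_forall fun t => by simp
  · simp
  · simp [simpleIntegral_zero]

theorem add (hf : IntegrableBySeminorm f) (hg : IntegrableBySeminorm g) :
    IntegrableBySeminorm (f + g) := by
  obtain ⟨s, h, hs⟩ := hf
  obtain ⟨r, k, hr⟩ := hg
  have key : ∀ (q : Seminorm ℝ E) (n : ℕ) (t : I),
      q ((s q n + r q n) t - (f + g) t) ≤ q (s q n t - f t) + q (r q n t - g t) := by
    intro q n t
    refine le_trans (le_of_eq ?_) (map_add_le_add q _ _)
    congr 1
    simp only [SimpleFunc.coe_add, Pi.add_apply]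
    abel
  have happ : ∀ q : Seminorm ℝ E, Continuous q →
      ApproxBySeminorm q (fun n => s q n + r q n) (f + g) := by
    intro q hq
    filter_upwards [(h q hq).1, (k q hq).1] with t h1 h2
    exact squeeze_zero (fun _ => apply_nonneg q _) (fun n => key q n t)
      (by simpa using h1.add h2)
  refine ⟨fun q n => s q n + r q n, fun q hq => ⟨happ q hq, fun n => ?_⟩, fun J hJ => ?_⟩
  · refine (((h q hq).2 n).add ((k q hq).2 n)).mono' ((happ q hq).aestronglyMeasurable _)
      (Eventually.of_forall fun t => ?_)
    rw [Real.norm_of_nonneg (apply_nonneg q _)]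
    exact key q n t
  · obtain ⟨F, hF⟩ := hs J hJ
    obtain ⟨G, hG⟩ := hr J hJ
    refine ⟨F + G, fun q hq => ?_⟩
    refine squeeze_zero (fun _ => apply_nonneg q _) (fun n => ?_)
      (by simpa using (hF q hq).add (hG q hq))
    rw [simpleIntegral_add _ _ hJ, add_sub_add_comm]
    exact map_add_le_add q _ _

theorem smul (c : ℝ) (hf : IntegrableBySeminorm f) : IntegrableBySeminorm (c • f) := by
  obtain ⟨s, h, hs⟩ := hf
  have key : ∀ (q : Seminorm ℝ E) (n : ℕ) (t : I),
      q ((s q n).map (fun y => c • y) t - (c • f) t) = |c| * q (s q n t - f t) := by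
    intro q n t
    rw [SimpleFunc.map_apply, Pi.smul_apply, ← smul_sub, map_smul_eq_mul, Real.norm_eq_abs]
  refine ⟨fun q n => (s q n).map (fun y => c • y), fun q hq => ⟨?_, fun n => ?_⟩,
    fun J hJ => ?_⟩
  · filter_upwards [(h q hq).1] with t ht
    simp only [key]
    simpa using ht.const_mul |c|
  · simp only [key]
    exact ((h q hq).2 n).const_mul _
  · obtain ⟨F, hF⟩ := hs J hJ
    refine ⟨c • F, fun q hq => ?_⟩
    simp only [simpleIntegral_smul _ _ hJ, ← smul_sub, map_smul_eq_mul]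
    simpa using (hF q hq).const_mul ‖c‖

end IntegrableBySeminorm

end IntegrabilityBySeminorm

/-! ### The locally convex space `L¹([0,1], E)` -/

section LebesgueSpace

variable (E : Type*) [AddCommGroup E] [Module ℝ E] [TopologicalSpace E]

/-- The functions `[0,1] → E` which are integrable by seminorm, as a linear subspace. -/
def preL1Submodule : Submodule ℝ (I → E) where
  carrier := {f | IntegrableBySeminorm f}
  add_mem' := fun hf hg => hf.add hg
  zero_mem' := IntegrableBySeminorm.zero
  smul_mem' := fun c _ hf => hf.smul c

/-- The space `ℒ¹([0,1], E)` of functions integrable by seminorm (before identifying functions).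
This is a type of its own so as not to inherit the topology of pointwise convergence. -/
def PreL1 : Type _ := preL1Submodule E

noncomputable instance : AddCommGroup (PreL1 E) := inferInstanceAs (AddCommGroup (preL1Submodule E))

noncomputable instance : Module ℝ (PreL1 E) := inferInstanceAs (Module ℝ (preL1Submodule E))

variable {E}

instance : CoeFun (PreL1 E) (fun _ => I → E) := ⟨fun f => f.1⟩

/-- The seminorm `f ↦ ∫₀¹ q (f t) dt` on `ℒ¹([0,1], E)`, for a continuous seminorm `q` on `E`. -/
noncomputable def PreL1.seminorm (q : {q : Seminorm ℝ E // Continuous q}) :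
    Seminorm ℝ (PreL1 E) :=
  Seminorm.of (fun f => ∫ t : I, q.1 (f t))
    (fun f g => by
      rw [← integral_add (f.2.integrable_seminorm q.2) (g.2.integrable_seminorm q.2)]
      exact integral_mono ((f + g).2.integrable_seminorm q.2)
        ((f.2.integrable_seminorm q.2).add (g.2.integrable_seminorm q.2))
        (fun t => map_add_le_add q.1 (f t) (g t)))
    (fun c f => by
      rw [← integral_const_mul]
      exact integral_congr_ae (Eventually.of_forall fun t => map_smul_eq_mul q.1 c (f t)))

variable (E)

/-- The locally convex topology of `ℒ¹([0,1], E)` defined by all the seminorms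
`f ↦ ∫₀¹ q (f t) dt`, where `q` is a continuous seminorm on `E`. -/
noncomputable instance : TopologicalSpace (PreL1 E) :=
  SeminormFamily.moduleFilterBasis
    (PreL1.seminorm : SeminormFamily ℝ (PreL1 E) {q : Seminorm ℝ E // Continuous q}) |>.topology

/-- The subspace of those `f` all of whose seminorms `∫₀¹ q (f t) dt` vanish. -/
noncomputable def nullFunctions : Submodule ℝ (PreL1 E) where
  carrier := {f | ∀ q : {q : Seminorm ℝ E // Continuous q}, PreL1.seminorm q f = 0}
  add_mem' := fun {f g} hf hg q => le_antisymm
    ((map_add_le_add _ f g).trans (by rw [hf q, hg q, add_zero])) (apply_nonneg _ _)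
  zero_mem' := fun q => map_zero _
  smul_mem' := fun c f hf q => by rw [map_smul_eq_mul, hf q, mul_zero]

/-- `L¹([0,1], E)`: the quotient of `ℒ¹([0,1], E)` by the null functions, with the quotient
topology. -/
abbrev SeminormL1 : Type _ := PreL1 E ⧸ nullFunctions E

end LebesgueSpace

/-! ### The Fréchet space `W^{∞,p}(ℝᵈ, ℝᵈ)` -/

section SobolevSpace

/-- The Euclidean space `ℝᵈ`. -/
abbrev Rd (d : ℕ) : Type := EuclideanSpace ℝ (Fin d)

variable (d : ℕ) (p : ℝ≥0∞)

/-- The smooth maps `f : ℝᵈ → ℝᵈ` all of whose derivatives, of every order `k ≥ 0`, belong to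
`L^p`, as a linear subspace. -/
def sobolevSubmodule : Submodule ℝ (Rd d → Rd d) where
  carrier := {f | ContDiff ℝ ∞ f ∧ ∀ k : ℕ, MemLp (iteratedFDeriv ℝ k f) p volume}
  add_mem' := by
    rintro f g ⟨hf, hf'⟩ ⟨hg, hg'⟩
    refine ⟨hf.add hg, fun k => ?_⟩
    rw [iteratedFDeriv_add (hf.of_le (mod_cast le_top)) (hg.of_le (mod_cast le_top))]
    exact (hf' k).add (hg' k)
  zero_mem' := by
    refine ⟨contDiff_const, fun k => ?_⟩
    have : iteratedFDeriv ℝ k (0 : Rd d → Rd d) = 0 := iteratedFDeriv_fun_zero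
    rw [this]
    exact MemLp.zero
  smul_mem' := by
    rintro c f ⟨hf, hf'⟩
    refine ⟨contDiff_const.smul hf, fun k => ?_⟩
    have h : iteratedFDeriv ℝ k (c • f) = c • iteratedFDeriv ℝ k f := funext fun x =>
      iteratedFDeriv_const_smul_apply (hf.of_le (mod_cast le_top)).contDiffAt
    rw [h]
    exact (hf' k).const_smul c

/-- The space `W^{∞,p}(ℝᵈ, ℝᵈ)`.
This is a type of its own so as not to inherit the topology of pointwise convergence. -/
def SobolevInf : Type := sobolevSubmodule d p

noncomputable instance : AddCommGroup (SobolevInf d p) :=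
  inferInstanceAs (AddCommGroup (sobolevSubmodule d p))

noncomputable instance : Module ℝ (SobolevInf d p) :=
  inferInstanceAs (Module ℝ (sobolevSubmodule d p))

instance : CoeFun (SobolevInf d p) (fun _ => Rd d → Rd d) := ⟨fun f => f.1⟩

variable [Fact (1 ≤ p)]

/-- The seminorm `f ↦ ‖f^{(k)}‖_{L^p}` on `W^{∞,p}(ℝᵈ, ℝᵈ)`, where the `k`-th Fréchet derivatives
`f^{(k)}(x)` are measured in the operator norm of `k`-linear maps. -/
noncomputable def SobolevInf.seminorm (k : ℕ) : Seminorm ℝ (SobolevInf d p) :=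
  Seminorm.of (fun f => (eLpNorm (iteratedFDeriv ℝ k f) p volume).toReal)
    (fun f g => by
      have h : iteratedFDeriv ℝ k (f + g : SobolevInf d p) =
          iteratedFDeriv ℝ k f + iteratedFDeriv ℝ k g :=
        iteratedFDeriv_add (f.2.1.of_le (mod_cast le_top)) (g.2.1.of_le (mod_cast le_top))
      rw [h, ← ENNReal.toReal_add (f.2.2 k).eLpNorm_ne_top (g.2.2 k).eLpNorm_ne_top]
      exact ENNReal.toReal_mono
        (ENNReal.add_ne_top.2 ⟨(f.2.2 k).eLpNorm_ne_top, (g.2.2 k).eLpNorm_ne_top⟩)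
        (eLpNorm_add_le (f.2.2 k).1 (g.2.2 k).1 Fact.out))
    (fun c f => by
      have h : iteratedFDeriv ℝ k (c • f : SobolevInf d p) = c • iteratedFDeriv ℝ k f :=
        funext fun x =>
          iteratedFDeriv_const_smul_apply (f.2.1.of_le (mod_cast le_top)).contDiffAt
      rw [h, eLpNorm_const_smul, ENNReal.toReal_mul, toReal_enorm])

/-- The Fréchet topology of `W^{∞,p}(ℝᵈ, ℝᵈ)`, defined by the seminorms `f ↦ ‖f^{(k)}‖_{L^p}`,
`k = 0, 1, 2, …`. -/
noncomputable instance : TopologicalSpace (SobolevInf d p) :=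
  SeminormFamily.moduleFilterBasis
    (SobolevInf.seminorm d p : SeminormFamily ℝ (SobolevInf d p) ℕ) |>.topology

end SobolevSpace

/-! ### Integral curves of time-dependent vector fields -/

/-- The continuous curve `y : [0,1] → ℝᵈ` solves `y t = x + ∫₀ᵗ u (s, y s) ds` for all `t`
(the integrand being Lebesgue integrable). -/
def IsIntegralSolution {d : ℕ} (u : I → Rd d → Rd d) (x : Rd d) (y : I → Rd d) : Prop :=
  Continuous y ∧ Integrable (fun s => u s (y s)) volume ∧
    ∀ t : I, y t = x + ∫ s in Set.Iic t, u s (y s)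

/-!
The flow is obtained as a limit of Euler schemes inside `E = W^{∞,p}(ℝᵈ, ℝᵈ)`. With the primitive
`U a = ∫_{s ≤ a} u s ds ∈ E`, the scheme with mesh `1 / n` has increments
`f i = U ((i + 1) / n) - U (i / n)` and the recursion `φ (i + 1) = φ i + f i ∘ (id + φ i)`; every
`φ i` belongs to `E`, so derivatives in the space variable of solutions of differential equations
never have to be constructed.

* The Sobolev inequality `SobolevInf.norm_iteratedFDeriv_le` bounds the derivatives pointwise by
  finitely many `L^p` norms, for all `1 ≤ p ≤ ∞` alike: one integrates the one-dimensional estimate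
  over a unit cube, coordinate by coordinate, and applies Hölder's inequality there.
* Composition is controlled pointwise. The map `g ↦ v ∘ (id + g)` is Lipschitz in the derivatives of
  order at most `k`, at the cost of one more derivative of `v`
  (`exists_norm_iteratedFDeriv_comp_id_add_sub_le`); comparison with `g = 0` shows that
  `f ∘ (id + g)` is in `E`, without any change of variables. Moreover the `k`-th derivative of
  `v ∘ (id + g)` depends on that of `g` in an affine way once the lower ones are bounded, so that
  the schemes are bounded order by order, by the discrete Grönwall inequality.
* Hence the scheme is Lipschitz in its increments (`SobolevInf.exists_jetNorm_euler_sub_le`), and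
  merging blocks of increments changes it by a multiple of the largest block
  (`SobolevInf.exists_jetNorm_euler_sub_euler_block_le`). Since the integrals of `‖u s‖` over short
  intervals are uniformly small, the schemes for finer and finer meshes converge in the complete
  space `E`, uniformly in time.
* The Lipschitz estimate passes to the limit. It gives continuity in time, since stopping `u` at
  time `t` is a continuous operation, local Lipschitz continuity in `u`, and the independence of the
  representative `u`.
* For a continuous curve `y`, the scheme is compared with `x + ∫ u s (y s) ds`
  (`PreL1.add_flow_eq_of_forall_norm_sub_le`). For `y = x + φ_u x` this shows that the flow solves
  the equation, and for an arbitrary solution `y` that it agrees with the flow.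

The definition of integrability by seminorm does not say that the simple functions converge in the
mean, so the integrals `∫_J u s ds ∈ E` are constructed from truncated simple functions and the
completeness of `E` (`PreL1.exists_setIntegral`).
-/

/-! ### The Sobolev inequality on unit cubes -/

section SobolevInequality

/-- A `C¹` function on an interval of length one is bounded by the `L¹` norms of itself and of its
derivative on this interval. -/
theorem enorm_le_lintegral_Icc_deriv {G : Type*} [NormedAddCommGroup G] [NormedSpace ℝ G]
    [CompleteSpace G] {g : ℝ → G} (hg : ContDiff ℝ 1 g) {a b : ℝ} (hb : b ∈ Set.Icc a (a + 1)) :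
    ‖g b‖ₑ ≤ ∫⁻ c in Set.Icc a (a + 1), (‖g c‖ₑ + ‖deriv g c‖ₑ) := by
  have hg' : Continuous (deriv g) := hg.continuous_deriv le_rfl
  have key : ∀ c ∈ Set.Icc a (a + 1),
      ‖g b‖ₑ ≤ ‖g c‖ₑ + ∫⁻ s in Set.Icc a (a + 1), ‖deriv g s‖ₑ := by
    intro c hc
    have h1 : ∫ s in c..b, deriv g s = g b - g c :=
      intervalIntegral.integral_deriv_eq_sub (fun x _ => hg.differentiable (by simp) x)
        (hg'.intervalIntegrable _ _)
    have h2 : ‖g b - g c‖ₑ ≤ ∫⁻ s in Set.Icc a (a + 1), ‖deriv g s‖ₑ := by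
      rw [← h1, ← ofReal_norm, intervalIntegral.norm_integral_eq_norm_integral_uIoc, ofReal_norm]
      exact (enorm_integral_le_lintegral_enorm _).trans (lintegral_mono_set
        (Set.uIoc_subset_uIcc.trans (Set.uIcc_subset_Icc hc hb)))
    calc ‖g b‖ₑ = ‖g c + (g b - g c)‖ₑ := by rw [add_sub_cancel]
      _ ≤ ‖g c‖ₑ + ‖g b - g c‖ₑ := enorm_add_le _ _
      _ ≤ _ := by gcongr
  calc ‖g b‖ₑ = ∫⁻ _ in Set.Icc a (a + 1), ‖g b‖ₑ := by simp
    _ ≤ ∫⁻ c in Set.Icc a (a + 1), (‖g c‖ₑ + ∫⁻ s in Set.Icc a (a + 1), ‖deriv g s‖ₑ) :=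
        setLIntegral_mono' measurableSet_Icc key
    _ = _ := by
        rw [lintegral_add_right _ measurable_const, lintegral_add_right _ hg'.enorm.measurable]
        simp

variable {d : ℕ}

/-- The sum of the pointwise norms of the derivatives of orders `j, …, j + m`, as a function of the
coordinates. -/
noncomputable def derivSum (f : Rd d → Rd d) (j m : ℕ) (x : Fin d → ℝ) : ℝ≥0∞ :=
  ∑ i ∈ Finset.range (m + 1), ‖iteratedFDeriv ℝ (j + i) f (WithLp.toLp 2 x)‖ₑ

theorem measurable_derivSum {f : Rd d → Rd d} (hf : ContDiff ℝ ∞ f) (j m : ℕ) :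
    Measurable (derivSum f j m) := by
  refine Finset.measurable_sum _ fun i _ => ?_
  have := hf.continuous_iteratedFDeriv (m := j + i) (mod_cast le_top)
  exact (this.comp (PiLp.continuous_toLp 2 _)).enorm.measurable

/-- The closed unit cube with lower corner `a`. -/
def unitCube (a : Fin d → ℝ) : Set (Fin d → ℝ) := Set.univ.pi fun i => Set.Icc (a i) (a i + 1)

theorem measurableSet_unitCube (a : Fin d → ℝ) : MeasurableSet (unitCube a) :=
  MeasurableSet.univ_pi fun _ => measurableSet_Icc

/-- One application of the one-dimensional inequality in the `i`-th coordinate. The indicator of the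
cube makes it valid at every point, so that it can be iterated. -/
theorem indicator_derivSum_le {f : Rd d → Rd d} (hf : ContDiff ℝ ∞ f) (j m : ℕ) (a : Fin d → ℝ)
    (i : Fin d) (x : Fin d → ℝ) :
    (unitCube a).indicator (derivSum f j m) x ≤
      2 * ∫⁻ c, (unitCube a).indicator (derivSum f j (m + 1)) (Function.update x i c) := by
  classical
  by_cases hx : x ∈ unitCube a
  swap
  · simp [hx]
  rw [Set.indicator_of_mem hx]
  have hmem : ∀ c, c ∈ Set.Icc (a i) (a i + 1) → Function.update x i c ∈ unitCube a := by
    intro c hc l _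
    by_cases hl : l = i
    · subst hl; simpa using hc
    · rw [Function.update_of_ne hl]; exact hx l trivial
  have hmeas : Measurable fun c : ℝ => derivSum f j (m + 1) (Function.update x i c) :=
    (measurable_derivSum hf j (m + 1)).comp (measurable_update x)
  have h1 : ∫⁻ c in Set.Icc (a i) (a i + 1), derivSum f j (m + 1) (Function.update x i c) ≤
      ∫⁻ c, (unitCube a).indicator (derivSum f j (m + 1)) (Function.update x i c) := by
    rw [← lintegral_indicator measurableSet_Icc]
    refine lintegral_mono fun c => ?_
    by_cases hc : c ∈ Set.Icc (a i) (a i + 1)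
    · rw [Set.indicator_of_mem hc, Set.indicator_of_mem (hmem c hc)]
    · simp [hc]
  refine le_trans ?_ (mul_le_mul_right h1 2)
  -- the line through `x` in direction of the `i`-th coordinate
  set γ : ℝ → Rd d := fun c => WithLp.toLp 2 (Function.update x i c) with hγ
  have hγd : ∀ c, HasDerivAt γ (EuclideanSpace.single i (1 : ℝ)) c := by
    intro c
    have h := (hasDerivAt_update x i c)
    exact (PiLp.continuousLinearEquiv 2 ℝ
      (fun _ : Fin d => ℝ)).symm.hasFDerivAt.comp_hasDerivAt c h
  have hterm : ∀ k, ‖iteratedFDeriv ℝ k f (WithLp.toLp 2 x)‖ₑ ≤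
      ∫⁻ c in Set.Icc (a i) (a i + 1), (‖iteratedFDeriv ℝ k f (γ c)‖ₑ +
        ‖iteratedFDeriv ℝ (k + 1) f (γ c)‖ₑ) := by
    intro k
    have hD : ContDiff ℝ 1 (iteratedFDeriv ℝ k f) :=
      hf.iteratedFDeriv_right (m := 1) (by norm_cast; exact le_top)
    have hγs : ContDiff ℝ 1 γ := by
      refine contDiff_one_iff_deriv.2 ⟨fun c => (hγd c).differentiableAt, ?_⟩
      rw [show deriv γ = fun _ => EuclideanSpace.single i (1 : ℝ) from
        funext fun c => (hγd c).deriv]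
      exact continuous_const
    have h := enorm_le_lintegral_Icc_deriv (hD.comp hγs) (a := a i) (b := x i) (hx i trivial)
    have hxi : γ (x i) = WithLp.toLp 2 x := by simp [hγ]
    rw [Function.comp_apply, hxi] at h
    refine h.trans (lintegral_mono fun c => ?_)
    dsimp only
    gcongr
    · exact le_rfl
    · have h2 := ((hD.differentiable (by simp) (γ c)).hasFDerivAt.comp_hasDerivAt c (hγd c)).deriv
      rw [h2, ← ofReal_norm, ← ofReal_norm]
      refine ENNReal.ofReal_le_ofReal ?_
      rw [← norm_fderiv_iteratedFDeriv]
      exact (ContinuousLinearMap.le_opNorm _ _).trans (by simp)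
  calc derivSum f j m x
      ≤ ∑ k ∈ Finset.range (m + 1), ∫⁻ c in Set.Icc (a i) (a i + 1),
        (‖iteratedFDeriv ℝ (j + k) f (γ c)‖ₑ + ‖iteratedFDeriv ℝ (j + k + 1) f (γ c)‖ₑ) :=
        Finset.sum_le_sum fun k _ => hterm _
    _ = ∫⁻ c in Set.Icc (a i) (a i + 1), ∑ k ∈ Finset.range (m + 1),
        (‖iteratedFDeriv ℝ (j + k) f (γ c)‖ₑ + ‖iteratedFDeriv ℝ (j + k + 1) f (γ c)‖ₑ) := by
        refine (lintegral_finsetSum' _ fun k _ => ?_).symm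
        have hγc : Continuous γ := continuous_iff_continuousAt.2 fun c => (hγd c).continuousAt
        have h1 := (hf.continuous_iteratedFDeriv (m := j + k) (mod_cast le_top)).comp hγc
        have h2 := (hf.continuous_iteratedFDeriv (m := j + k + 1) (mod_cast le_top)).comp hγc
        exact (h1.enorm.measurable.add h2.enorm.measurable).aemeasurable
    _ ≤ ∫⁻ c in Set.Icc (a i) (a i + 1), 2 * derivSum f j (m + 1) (Function.update x i c) := by
        refine lintegral_mono fun c => ?_
        dsimp only
        rw [Finset.sum_add_distrib, two_mul]
        unfold derivSum
        refine add_le_add (Finset.sum_le_sum_of_subset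
          (Finset.range_mono (Nat.le_succ (m + 1)))) ?_
        rw [Finset.sum_range_succ' _ (m + 1)]
        exact le_add_of_nonneg_right bot_le
    _ = _ := lintegral_const_mul _ hmeas

/-- Sobolev inequality: the derivatives at a point are bounded by the `L¹` norms of derivatives of
order up to `d` higher, on a unit cube. -/
theorem enorm_iteratedFDeriv_le_lintegral {f : Rd d → Rd d} (hf : ContDiff ℝ ∞ f) (j : ℕ)
    (a : Fin d → ℝ) :
    ‖iteratedFDeriv ℝ j f (WithLp.toLp 2 a)‖ₑ ≤ 2 ^ d * ∫⁻ x in unitCube a, derivSum f j d x := by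
  classical
  have hm : ∀ m, Measurable ((unitCube a).indicator (derivSum f j m)) := fun m =>
    (measurable_derivSum hf j m).indicator (measurableSet_unitCube a)
  have key : ∀ s : Finset (Fin d), ∀ x, (unitCube a).indicator (derivSum f j 0) x ≤
      2 ^ s.card * (∫⋯∫⁻_s, (unitCube a).indicator (derivSum f j s.card) ∂fun _ => volume) x := by
    intro s
    induction s using Finset.induction_on with
    | empty => intro x; simp
    | insert i s hi ih =>
      intro x
      refine (ih x).trans ?_
      rw [Finset.card_insert_of_notMem hi, lmarginal_insert' _ (hm _) hi, pow_succ, mul_assoc]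
      gcongr
      have h2 : (unitCube a).indicator (derivSum f j s.card) ≤ fun x =>
          2 * ∫⁻ c, (unitCube a).indicator (derivSum f j (s.card + 1)) (Function.update x i c) :=
        fun x => indicator_derivSum_le hf j _ a i x
      refine (lmarginal_mono (μ := fun _ => volume) (s := s) h2 x).trans (le_of_eq ?_)
      unfold lmarginal
      refine lintegral_const_mul _ ?_
      have h3 : Measurable fun x : Fin d → ℝ =>
          ∫⁻ c, (unitCube a).indicator (derivSum f j (s.card + 1)) (Function.update x i c) := by
        refine Measurable.lintegral_prod_right' (ν := (volume : Measure ℝ))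
          (f := fun z : (Fin d → ℝ) × ℝ =>
            (unitCube a).indicator (derivSum f j (s.card + 1)) (Function.update z.1 i z.2)) ?_
        exact (hm _).comp measurable_update'
      exact h3.comp measurable_updateFinset
  have h := key Finset.univ a
  have ha : a ∈ unitCube a := fun i _ => ⟨le_rfl, by linarith⟩
  rw [Set.indicator_of_mem ha, lmarginal_univ, Finset.card_univ, Fintype.card_fin,
    lintegral_indicator (measurableSet_unitCube a)] at h
  rw [← volume_pi] at h
  simpa [derivSum] using h

variable {p : ℝ≥0∞} [Fact (1 ≤ p)]

/-- Sobolev inequality in terms of `L^p` norms, for all `1 ≤ p ≤ ∞`: by Hölder's inequality on unit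
cubes. -/
theorem enorm_iteratedFDeriv_le_sum_eLpNorm {f : Rd d → Rd d} (hf : ContDiff ℝ ∞ f) (j : ℕ)
    (x : Rd d) :
    ‖iteratedFDeriv ℝ j f x‖ₑ ≤
      2 ^ d * ∑ i ∈ Finset.range (d + 1), eLpNorm (iteratedFDeriv ℝ (j + i) f) p volume := by
  refine (enorm_iteratedFDeriv_le_lintegral hf j (WithLp.ofLp x)).trans ?_
  gcongr
  have hc : ∀ i, Continuous fun y : Fin d → ℝ => iteratedFDeriv ℝ (j + i) f (WithLp.toLp 2 y) :=
    fun i => (hf.continuous_iteratedFDeriv (m := j + i) (mod_cast le_top)).comp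
      (PiLp.continuous_toLp 2 _)
  unfold derivSum
  rw [lintegral_finsetSum' _ fun i _ => (hc i).enorm.measurable.aemeasurable]
  refine Finset.sum_le_sum fun i _ => ?_
  have hprob : IsProbabilityMeasure ((volume : Measure (Fin d → ℝ)).restrict
      (unitCube (WithLp.ofLp x))) := by
    constructor
    rw [Measure.restrict_apply_univ, unitCube, volume_pi_pi]
    simp
  rw [← eLpNorm_one_eq_lintegral_enorm]
  refine (eLpNorm_le_eLpNorm_of_exponent_le (Fact.out : 1 ≤ p)
    (hc i).aestronglyMeasurable).trans ?_
  refine (eLpNorm_mono_measure _ Measure.restrict_le_self).trans (le_of_eq ?_)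
  exact eLpNorm_comp_measurePreserving
    (hf.continuous_iteratedFDeriv (m := j + i) (mod_cast le_top)).aestronglyMeasurable
    (PiLp.volume_preserving_toLp (Fin d))

end SobolevInequality

/-! ### Derivatives of `v ∘ (id + g)` -/

section Composition

variable {V G : Type} [NormedAddCommGroup V] [NormedSpace ℝ V] [NormedAddCommGroup G]
  [NormedSpace ℝ G]

theorem ContDiff.comp_id_add {v : V → G} {g : V → V} (hv : ContDiff ℝ ∞ v)
    (hg : ContDiff ℝ ∞ g) : ContDiff ℝ ∞ fun y => v (y + g y) :=
  hv.comp (contDiff_id.add hg)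

theorem fderiv_comp_id_add {v : V → G} {g : V → V} (hv : ContDiff ℝ ∞ v) (hg : ContDiff ℝ ∞ g) :
    fderiv ℝ (fun y => v (y + g y)) =
      fun y => (fderiv ℝ v (y + g y)).comp (ContinuousLinearMap.id ℝ V + fderiv ℝ g y) := by
  funext y
  have h1 : HasFDerivAt (fun y => y + g y) (ContinuousLinearMap.id ℝ V + fderiv ℝ g y) y :=
    (hasFDerivAt_id y).add (hg.differentiable (by simp) y).hasFDerivAt
  exact ((hv.differentiable (by simp) (y + g y)).hasFDerivAt.comp y h1).fderiv

theorem norm_iteratedFDeriv_id_add_fderiv_le {g : V → V} (hg : ContDiff ℝ ∞ g) (m : ℕ) (x : V) :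
    ‖iteratedFDeriv ℝ m (fun y => ContinuousLinearMap.id ℝ V + fderiv ℝ g y) x‖ ≤
      1 + ‖iteratedFDeriv ℝ (m + 1) g x‖ := by
  have hg' : ContDiff ℝ ∞ (fderiv ℝ g) := hg.fderiv_right (by simp)
  have h : iteratedFDeriv ℝ m (fun y => ContinuousLinearMap.id ℝ V + fderiv ℝ g y) x =
      iteratedFDeriv ℝ m (fun _ : V => ContinuousLinearMap.id ℝ V) x +
        iteratedFDeriv ℝ m (fderiv ℝ g) x :=
    iteratedFDeriv_add_apply contDiff_const.contDiffAt
      (hg'.of_le (mod_cast le_top)).contDiffAt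
  rw [h, ← norm_iteratedFDeriv_fderiv]
  refine (norm_add_le _ _).trans (add_le_add_left ?_ _)
  rcases Nat.eq_zero_or_pos m with rfl | hm
  · simpa using ContinuousLinearMap.norm_id_le
  · rw [iteratedFDeriv_const_of_ne hm.ne']
    simp

theorem norm_iteratedFDeriv_comp_id_add_le {v : V → G} {g : V → V} (hv : ContDiff ℝ ∞ v)
    (hg : ContDiff ℝ ∞ g) {k : ℕ} {R B : ℝ} {x : V}
    (hB : ∀ j ≤ k, ‖iteratedFDeriv ℝ j v (x + g x)‖ ≤ B)
    (hR : ∀ j ≤ k, ‖iteratedFDeriv ℝ j g x‖ ≤ R) :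
    ‖iteratedFDeriv ℝ k (fun y => v (y + g y)) x‖ ≤ k.factorial * (1 + R) ^ k * B := by
  have hR0 : 0 ≤ R := (norm_nonneg _).trans (hR 0 (Nat.zero_le _))
  have h := norm_iteratedFDeriv_comp_le (n := k) (N := ∞) (g := v) (f := fun y => y + g y) hv
    (contDiff_id.add hg) (mod_cast le_top) x (C := B) (D := 1 + R) hB ?_
  · refine h.trans (le_of_eq (by ring))
  · rintro i hi hik
    obtain ⟨m, rfl⟩ : ∃ m, i = m + 1 := ⟨i - 1, by omega⟩
    have h1 : fderiv ℝ (fun y => y + g y) =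
        fun y => ContinuousLinearMap.id ℝ V + fderiv ℝ g y := by
      have := fderiv_comp_id_add (v := fun y : V => y) contDiff_id hg
      simpa using this
    rw [← norm_iteratedFDeriv_fderiv, h1]
    refine (norm_iteratedFDeriv_id_add_fderiv_le hg m x).trans ?_
    calc 1 + ‖iteratedFDeriv ℝ (m + 1) g x‖ ≤ 1 + R := by gcongr; exact hR _ hik
      _ = (1 + R) ^ 1 := (pow_one _).symm
      _ ≤ (1 + R) ^ (m + 1) := pow_le_pow_right₀ (by linarith) (by omega)

theorem norm_iteratedFDeriv_clm_comp_le {f : V → V →L[ℝ] G} {g : V → V →L[ℝ] V}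
    (hf : ContDiff ℝ ∞ f) (hg : ContDiff ℝ ∞ g) (m : ℕ) (x : V) :
    ‖iteratedFDeriv ℝ m (fun y => (f y).comp (g y)) x‖ ≤ ∑ i ∈ Finset.range (m + 1),
      (m.choose i : ℝ) * ‖iteratedFDeriv ℝ i f x‖ * ‖iteratedFDeriv ℝ (m - i) g x‖ :=
  (ContinuousLinearMap.compL ℝ V V G).norm_iteratedFDeriv_le_of_bilinear_of_le_one hf hg x
    (mod_cast le_top) (ContinuousLinearMap.norm_compL_le ℝ V V G)

/-- The derivative of order `k` of `v ∘ (id + g)` is bounded by an affine function of the derivative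
of order `k` of `g`, if bounds for the lower derivatives of `g` are known. -/
theorem exists_norm_iteratedFDeriv_comp_id_add_le_affine (k : ℕ) {R : ℝ} (hR0 : 0 ≤ R) :
    ∃ C : ℝ, 0 ≤ C ∧ ∀ (v : V → G) (g : V → V) (x : V) (B : ℝ),
      ContDiff ℝ ∞ v → ContDiff ℝ ∞ g →
      (∀ j ≤ k, ‖iteratedFDeriv ℝ j v (x + g x)‖ ≤ B) →
      (∀ j < k, ‖iteratedFDeriv ℝ j g x‖ ≤ R) →
      ‖iteratedFDeriv ℝ k (fun y => v (y + g y)) x‖ ≤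
        C * B * (1 + ‖iteratedFDeriv ℝ k g x‖) := by
  rcases Nat.eq_zero_or_pos k with rfl | hk
  · refine ⟨1, zero_le_one, fun v g x B _ _ hB _ => ?_⟩
    have h1 := hB 0 le_rfl
    rw [norm_iteratedFDeriv_zero] at h1 ⊢
    have hB0 : 0 ≤ B := (norm_nonneg _).trans h1
    rw [one_mul]
    exact h1.trans (le_mul_of_one_le_right hB0 (by linarith [norm_nonneg (iteratedFDeriv ℝ 0 g x)]))
  obtain ⟨m, rfl⟩ : ∃ m, k = m + 1 := ⟨k - 1, by omega⟩
  refine ⟨∑ i ∈ Finset.range (m + 1), (m.choose i : ℝ) * (i.factorial * (1 + R) ^ i) * (1 + R),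
    by positivity, fun v g x B hv hg hB hR => ?_⟩
  have hB0 : 0 ≤ B := (norm_nonneg _).trans (hB 0 (Nat.zero_le _))
  have hv' : ContDiff ℝ ∞ (fderiv ℝ v) := hv.fderiv_right (by simp)
  have hg' : ContDiff ℝ ∞ (fderiv ℝ g) := hg.fderiv_right (by simp)
  rw [← norm_iteratedFDeriv_fderiv, fderiv_comp_id_add hv hg]
  refine (norm_iteratedFDeriv_clm_comp_le (hv'.comp_id_add hg)
    (contDiff_const.add hg') m x).trans ?_
  rw [Finset.sum_mul, Finset.sum_mul]
  refine Finset.sum_le_sum fun i hi => ?_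
  have him : i ≤ m := Nat.lt_succ_iff.1 (Finset.mem_range.1 hi)
  have h1 : ‖iteratedFDeriv ℝ i (fun y => fderiv ℝ v (y + g y)) x‖ ≤
      i.factorial * (1 + R) ^ i * B := by
    refine norm_iteratedFDeriv_comp_id_add_le hv' hg (fun j hj => ?_)
      (fun j hj => hR j (by omega))
    rw [norm_iteratedFDeriv_fderiv]
    exact hB _ (by omega)
  have h2 : ‖iteratedFDeriv ℝ (m - i) (fun y => ContinuousLinearMap.id ℝ V + fderiv ℝ g y) x‖ ≤
      (1 + R) * (1 + ‖iteratedFDeriv ℝ (m + 1) g x‖) := by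
    refine (norm_iteratedFDeriv_id_add_fderiv_le hg _ x).trans ?_
    have hn := norm_nonneg (iteratedFDeriv ℝ (m + 1) g x)
    rcases Nat.eq_zero_or_pos i with rfl | hi0
    · rw [Nat.sub_zero]; nlinarith
    · have := hR (m - i + 1) (by omega)
      nlinarith
  calc _ ≤ (m.choose i : ℝ) * (i.factorial * (1 + R) ^ i * B) *
        ((1 + R) * (1 + ‖iteratedFDeriv ℝ (m + 1) g x‖)) := by gcongr
    _ = _ := by ring

end Composition

section CompositionLipschitz

variable {V : Type} [NormedAddCommGroup V] [NormedSpace ℝ V]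

/-- Pointwise Lipschitz estimate for `g ↦ v ∘ (id + g)`, at the cost of one derivative of `v`. -/
theorem exists_norm_iteratedFDeriv_comp_id_add_sub_le (k : ℕ) {R : ℝ} (hR0 : 0 ≤ R) :
    ∃ C : ℝ, 0 ≤ C ∧ ∀ (G : Type) [NormedAddCommGroup G] [NormedSpace ℝ G]
      (v : V → G) (g h : V → V) (x : V) (B : ℝ),
      ContDiff ℝ ∞ v → ContDiff ℝ ∞ g → ContDiff ℝ ∞ h →
      (∀ j ≤ k + 1, ∀ z, ‖iteratedFDeriv ℝ j v z‖ ≤ B) →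
      (∀ j ≤ k, ‖iteratedFDeriv ℝ j g x‖ ≤ R) → (∀ j ≤ k, ‖iteratedFDeriv ℝ j h x‖ ≤ R) →
      ‖iteratedFDeriv ℝ k (fun y => v (y + g y) - v (y + h y)) x‖ ≤
        C * B * ∑ j ∈ Finset.range (k + 1), ‖iteratedFDeriv ℝ j (fun y => g y - h y) x‖ := by
  induction k using Nat.strong_induction_on with
  | _ k ih =>
  rcases Nat.eq_zero_or_pos k with rfl | hk
  · refine ⟨1, zero_le_one, fun G _ _ v g h x B hv _ _ hB _ _ => ?_⟩
    simp only [norm_iteratedFDeriv_zero, zero_add, Finset.sum_range_one, one_mul]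
    have := convex_univ.norm_image_sub_le_of_norm_fderiv_le (𝕜 := ℝ) (f := v) (C := B)
      (x := x + h x) (y := x + g x) (fun z _ => hv.differentiable (by simp) z)
      (fun z _ => by
        have := hB 1 le_rfl z
        rwa [norm_iteratedFDeriv_one] at this)
      trivial trivial
    simpa using this
  obtain ⟨m, rfl⟩ : ∃ m, k = m + 1 := ⟨k - 1, by omega⟩
  choose C hC0 hC using ih
  let D : ℕ → ℝ := fun i => if hi : i < m + 1 then C i hi else 0
  have hD0 : ∀ i, 0 ≤ D i := fun i => by
    by_cases hi : i < m + 1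
    · rw [show D i = C i hi from dif_pos hi]
      exact hC0 i hi
    · exact ge_of_eq (show D i = 0 from dif_neg hi)
  refine ⟨∑ i ∈ Finset.range (m + 1), (m.choose i : ℝ) * D i * (1 + R) +
    ∑ i ∈ Finset.range (m + 1), (m.choose i : ℝ) * (i.factorial * (1 + R) ^ i), ?_, ?_⟩
  · exact add_nonneg (Finset.sum_nonneg fun i _ => mul_nonneg (mul_nonneg (by positivity) (hD0 i))
      (by positivity)) (by positivity)
  intro G _ _ v g h x B hv hg hh hB hgR hhR
  have hB0 : 0 ≤ B := (norm_nonneg _).trans (hB 0 (Nat.zero_le _) x)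
  have hv' : ContDiff ℝ ∞ (fderiv ℝ v) := hv.fderiv_right (by simp)
  have hg' : ContDiff ℝ ∞ (fderiv ℝ g) := hg.fderiv_right (by simp)
  have hh' : ContDiff ℝ ∞ (fderiv ℝ h) := hh.fderiv_right (by simp)
  have hvB : ∀ j ≤ m + 1, ∀ z, ‖iteratedFDeriv ℝ j (fderiv ℝ v) z‖ ≤ B := fun j hj z => by
    rw [norm_iteratedFDeriv_fderiv]; exact hB _ (by omega) z
  set S := ∑ j ∈ Finset.range (m + 1 + 1), ‖iteratedFDeriv ℝ j (fun y => g y - h y) x‖ with hS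
  have hS0 : 0 ≤ S := Finset.sum_nonneg fun _ _ => norm_nonneg _
  have hfd : fderiv ℝ (fun y => v (y + g y) - v (y + h y)) =
      (fun y => (fderiv ℝ v (y + g y) - fderiv ℝ v (y + h y)).comp
        (ContinuousLinearMap.id ℝ V + fderiv ℝ g y)) +
      fun y => (fderiv ℝ v (y + h y)).comp (fderiv ℝ g y - fderiv ℝ h y) := by
    funext y
    have e1 := congrFun (fderiv_comp_id_add hv hg) y
    have e2 := congrFun (fderiv_comp_id_add hv hh) y
    rw [fderiv_fun_sub ((hv.comp_id_add hg).differentiable (by simp) y)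
      ((hv.comp_id_add hh).differentiable (by simp) y), e1, e2]
    ext z
    simp only [sub_apply, ContinuousLinearMap.comp_apply, add_apply, Pi.add_apply, map_add, map_sub]
    abel
  have hP : ContDiff ℝ ∞ fun y => fderiv ℝ v (y + g y) - fderiv ℝ v (y + h y) :=
    (hv'.comp_id_add hg).sub (hv'.comp_id_add hh)
  have hfgh : fderiv ℝ (fun y => g y - h y) = fun y => fderiv ℝ g y - fderiv ℝ h y :=
    funext fun y => fderiv_fun_sub (hg.differentiable (by simp) y) (hh.differentiable (by simp) y)
  rw [← norm_iteratedFDeriv_fderiv, hfd, iteratedFDeriv_add_apply]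
  rotate_left
  · exact ((hP.clm_comp (contDiff_const.add hg')).of_le (mod_cast le_top)).contDiffAt
  · exact (((hv'.comp_id_add hh).clm_comp (hg'.sub hh')).of_le (mod_cast le_top)).contDiffAt
  refine (norm_add_le _ _).trans ?_
  rw [add_mul, add_mul]
  refine add_le_add ?_ ?_
  · refine (norm_iteratedFDeriv_clm_comp_le hP (contDiff_const.add hg') m x).trans ?_
    rw [Finset.sum_mul, Finset.sum_mul]
    refine Finset.sum_le_sum fun i hi => ?_
    have him : i < m + 1 := Finset.mem_range.1 hi
    have h1 : ‖iteratedFDeriv ℝ i (fun y => fderiv ℝ v (y + g y) - fderiv ℝ v (y + h y)) x‖ ≤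
        D i * B * S := by
      have := hC i him _ (fderiv ℝ v) g h x B hv' hg hh (fun j hj => hvB j (by omega))
        (fun j hj => hgR j (by omega)) (fun j hj => hhR j (by omega))
      rw [show D i = C i him from dif_pos him]
      refine this.trans ?_
      have := hC0 i him
      gcongr
      exact Finset.sum_le_sum_of_subset_of_nonneg (Finset.range_mono (by omega))
        fun _ _ _ => norm_nonneg _
    have h2 := (norm_iteratedFDeriv_id_add_fderiv_le hg (m - i) x).trans
      (add_le_add_right (hgR (m - i + 1) (by omega)) 1)
    have := hD0 i
    calc _ ≤ (m.choose i : ℝ) * (D i * B * S) * (1 + R) := by gcongr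
      _ = _ := by ring
  · refine (norm_iteratedFDeriv_clm_comp_le (hv'.comp_id_add hh) (hg'.sub hh') m x).trans ?_
    rw [Finset.sum_mul, Finset.sum_mul]
    refine Finset.sum_le_sum fun i hi => ?_
    have him : i < m + 1 := Finset.mem_range.1 hi
    have h1 : ‖iteratedFDeriv ℝ i (fun y => fderiv ℝ v (y + h y)) x‖ ≤
        i.factorial * (1 + R) ^ i * B :=
      norm_iteratedFDeriv_comp_id_add_le hv' hh (fun j hj => hvB j (by omega) _)
        (fun j hj => hhR j (by omega))
    have h2 : ‖iteratedFDeriv ℝ (m - i) (fun y => fderiv ℝ g y - fderiv ℝ h y) x‖ ≤ S := by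
      rw [← hfgh, norm_iteratedFDeriv_fderiv]
      exact Finset.single_le_sum (f := fun j => ‖iteratedFDeriv ℝ j (fun y => g y - h y) x‖)
        (fun _ _ => norm_nonneg _) (Finset.mem_range.2 (by omega))
    calc _ ≤ (m.choose i : ℝ) * (i.factorial * (1 + R) ^ i * B) * S := by gcongr
      _ = _ := by ring

end CompositionLipschitz

/-! ### Norms on `W^{∞,p}` and composition with `id + g` -/

namespace SobolevInf

variable {d : ℕ} {p : ℝ≥0∞}

theorem ext {f g : SobolevInf d p} (h : ∀ x, f x = g x) : f = g := Subtype.ext (funext h)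

theorem contDiff (f : SobolevInf d p) : ContDiff ℝ ∞ f := f.2.1

theorem memLp (f : SobolevInf d p) (k : ℕ) : MemLp (iteratedFDeriv ℝ k f) p volume := f.2.2 k

theorem add_apply (f g : SobolevInf d p) (x : Rd d) : (f + g) x = f x + g x := rfl

theorem sub_apply (f g : SobolevInf d p) (x : Rd d) : (f - g) x = f x - g x := rfl

theorem zero_apply (x : Rd d) : (0 : SobolevInf d p) x = 0 := rfl

/-- Evaluation at a point, as a linear map. -/
def eval (x : Rd d) : SobolevInf d p →ₗ[ℝ] Rd d where
  toFun f := f x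
  map_add' _ _ := rfl
  map_smul' _ _ := rfl

theorem iteratedFDeriv_sub (f g : SobolevInf d p) (k : ℕ) (x : Rd d) :
    iteratedFDeriv ℝ k (f - g : SobolevInf d p) x =
      iteratedFDeriv ℝ k f x - iteratedFDeriv ℝ k g x :=
  iteratedFDeriv_sub_apply (f.contDiff.of_le (mod_cast le_top)).contDiffAt
    (g.contDiff.of_le (mod_cast le_top)).contDiffAt

theorem iteratedFDeriv_add (f g : SobolevInf d p) (k : ℕ) (x : Rd d) :
    iteratedFDeriv ℝ k (f + g : SobolevInf d p) x =
      iteratedFDeriv ℝ k f x + iteratedFDeriv ℝ k g x :=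
  iteratedFDeriv_add_apply (f.contDiff.of_le (mod_cast le_top)).contDiffAt
    (g.contDiff.of_le (mod_cast le_top)).contDiffAt

theorem iteratedFDeriv_zero (k : ℕ) (x : Rd d) :
    iteratedFDeriv ℝ k (0 : SobolevInf d p) x = 0 := by
  have : iteratedFDeriv ℝ k ((0 : SobolevInf d p) : Rd d → Rd d) = 0 := iteratedFDeriv_fun_zero
  rw [this]; rfl

variable [Fact (1 ≤ p)]

theorem withSeminorms : WithSeminorms (SobolevInf.seminorm d p) := ⟨rfl⟩

theorem seminorm_apply (k : ℕ) (f : SobolevInf d p) :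
    SobolevInf.seminorm d p k f = (eLpNorm (iteratedFDeriv ℝ k f) p volume).toReal := rfl

theorem ofReal_seminorm (k : ℕ) (f : SobolevInf d p) :
    ENNReal.ofReal (SobolevInf.seminorm d p k f) = eLpNorm (iteratedFDeriv ℝ k f) p volume :=
  ENNReal.ofReal_toReal (f.memLp k).eLpNorm_ne_top

variable (d p) in
/-- The norm `f ↦ ∑_{j ≤ k} ‖f^{(j)}‖_{L^p}`. -/
noncomputable def jetNorm (k : ℕ) : Seminorm ℝ (SobolevInf d p) :=
  ∑ j ∈ Finset.range (k + 1), SobolevInf.seminorm d p j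

theorem jetNorm_apply (k : ℕ) (f : SobolevInf d p) :
    jetNorm d p k f = ∑ j ∈ Finset.range (k + 1), SobolevInf.seminorm d p j f := by
  rw [jetNorm, ← FunLike.coeAddMonoidHom_apply, map_sum, Finset.sum_apply]
  rfl

theorem jetNorm_mono {k l : ℕ} (h : k ≤ l) (f : SobolevInf d p) :
    jetNorm d p k f ≤ jetNorm d p l f := by
  rw [jetNorm_apply, jetNorm_apply]
  exact Finset.sum_le_sum_of_subset_of_nonneg (Finset.range_mono (by omega))
    fun _ _ _ => apply_nonneg _ _

theorem seminorm_le_jetNorm {k l : ℕ} (h : k ≤ l) (f : SobolevInf d p) :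
    SobolevInf.seminorm d p k f ≤ jetNorm d p l f := by
  rw [jetNorm_apply]
  exact Finset.single_le_sum (f := fun j => SobolevInf.seminorm d p j f)
    (fun _ _ => apply_nonneg _ _) (Finset.mem_range.2 (by omega))

theorem continuous_jetNorm (k : ℕ) : Continuous (jetNorm d p k) := by
  have : (jetNorm d p k : SobolevInf d p → ℝ) =
      fun f => ∑ j ∈ Finset.range (k + 1), SobolevInf.seminorm d p j f :=
    funext fun f => jetNorm_apply k f
  rw [this]
  exact continuous_finsetSum _ fun j _ => withSeminorms.continuous_seminorm j

/-- Sobolev inequality: the derivatives of order at most `k` are bounded by `jetNorm (k + d)`. -/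
theorem norm_iteratedFDeriv_le {j k : ℕ} (hj : j ≤ k) (f : SobolevInf d p) (x : Rd d) :
    ‖iteratedFDeriv ℝ j f x‖ ≤ 2 ^ d * jetNorm d p (k + d) f := by
  have h := enorm_iteratedFDeriv_le_sum_eLpNorm (p := p) f.contDiff j x
  have h2 : ∑ i ∈ Finset.range (d + 1), eLpNorm (iteratedFDeriv ℝ (j + i) f) p volume =
      ENNReal.ofReal (∑ i ∈ Finset.range (d + 1), SobolevInf.seminorm d p (j + i) f) := by
    rw [ENNReal.ofReal_sum_of_nonneg fun _ _ => apply_nonneg _ _]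
    exact Finset.sum_congr rfl fun i _ => (ofReal_seminorm _ f).symm
  rw [h2, ← ofReal_norm, show (2 : ℝ≥0∞) ^ d = ENNReal.ofReal (2 ^ d) by
    rw [ENNReal.ofReal_pow zero_le_two]; simp, ← ENNReal.ofReal_mul (by positivity)] at h
  have h3 := (ENNReal.ofReal_le_ofReal_iff (mul_nonneg (by positivity)
    (Finset.sum_nonneg fun _ _ => apply_nonneg _ _))).1 h
  refine h3.trans ?_
  gcongr
  rw [jetNorm_apply, ← Finset.sum_image (s := Finset.range (d + 1)) (g := fun i => j + i)
    (f := fun i => SobolevInf.seminorm d p i f) (fun a _ b _ h => Nat.add_left_cancel h)]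
  refine Finset.sum_le_sum_of_subset_of_nonneg ?_ fun _ _ _ => apply_nonneg _ _
  intro i hi
  simp only [Finset.mem_image, Finset.mem_range] at hi ⊢
  omega

theorem norm_apply_le (f : SobolevInf d p) (x : Rd d) : ‖f x‖ ≤ 2 ^ d * jetNorm d p d f := by
  have := norm_iteratedFDeriv_le (le_refl 0) f x
  rwa [norm_iteratedFDeriv_zero, zero_add] at this

theorem norm_sub_apply_le (f : SobolevInf d p) (x y : Rd d) :
    ‖f x - f y‖ ≤ 2 ^ d * jetNorm d p (1 + d) f * ‖x - y‖ := by
  refine convex_univ.norm_image_sub_le_of_norm_fderiv_le (𝕜 := ℝ)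
    (fun z _ => f.contDiff.differentiable (by simp) z) (fun z _ => ?_) trivial trivial
  have := norm_iteratedFDeriv_le (le_refl 1) f z
  rwa [norm_iteratedFDeriv_one] at this

/-- A pointwise bound for a derivative gives a bound for its `L^p` norm. -/
theorem seminorm_le_of_forall_norm_le {k : ℕ} {c : ℝ} (hc : 0 ≤ c) {f g : SobolevInf d p}
    (h : ∀ x, ‖iteratedFDeriv ℝ k f x‖ ≤
      c * ∑ j ∈ Finset.range (k + 1), ‖iteratedFDeriv ℝ j g x‖) :
    SobolevInf.seminorm d p k f ≤ c * jetNorm d p k g := by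
  have h1 : eLpNorm (iteratedFDeriv ℝ k f) p volume ≤
      ENNReal.ofReal (c * jetNorm d p k g) := by
    calc eLpNorm (iteratedFDeriv ℝ k f) p volume
        ≤ eLpNorm (c • ∑ j ∈ Finset.range (k + 1), fun x => ‖iteratedFDeriv ℝ j g x‖) p volume := by
          refine eLpNorm_mono_real fun x => ?_
          simpa using h x
      _ = ENNReal.ofReal c * eLpNorm (∑ j ∈ Finset.range (k + 1),
          fun x => ‖iteratedFDeriv ℝ j g x‖) p volume := by
          rw [eLpNorm_const_smul, ← ofReal_norm, Real.norm_of_nonneg hc]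
      _ ≤ ENNReal.ofReal c * ∑ j ∈ Finset.range (k + 1),
          eLpNorm (fun x => ‖iteratedFDeriv ℝ j g x‖) p volume := by
          gcongr
          exact eLpNorm_sum_le (fun j _ => (g.memLp j).1.norm) Fact.out
      _ = ENNReal.ofReal (c * jetNorm d p k g) := by
          rw [ENNReal.ofReal_mul hc, jetNorm_apply,
            ENNReal.ofReal_sum_of_nonneg fun _ _ => apply_nonneg _ _]
          congr 1
          refine Finset.sum_congr rfl fun j _ => ?_
          rw [ofReal_seminorm, eLpNorm_norm]
  rw [← ofReal_seminorm] at h1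
  exact (ENNReal.ofReal_le_ofReal_iff (mul_nonneg hc (apply_nonneg _ _))).1 h1

/-- The composition `f ∘ (id + g)`. -/
def comp (f g : SobolevInf d p) : SobolevInf d p :=
  ⟨fun x => f (x + g x), f.contDiff.comp_id_add g.contDiff, fun k => by
    obtain ⟨C, -, hC⟩ := exists_norm_iteratedFDeriv_comp_id_add_sub_le (V := Rd d) k
      (R := 2 ^ d * jetNorm d p (k + d) g) (by positivity)
    have hs := f.contDiff.comp_id_add g.contDiff
    have h := fun x => hC (Rd d) f g (0 : SobolevInf d p) x (2 ^ d * jetNorm d p (k + 1 + d) f)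
      f.contDiff g.contDiff contDiff_const (fun j hj z => norm_iteratedFDeriv_le hj f z)
      (fun j hj => norm_iteratedFDeriv_le hj g x)
      (fun j _ => by rw [iteratedFDeriv_zero, norm_zero]; positivity)
    simp only [zero_apply, add_zero, sub_zero] at h
    have hbd : MemLp (fun x => ‖iteratedFDeriv ℝ k f x‖ +
        C * (2 ^ d * jetNorm d p (k + 1 + d) f) *
          ∑ j ∈ Finset.range (k + 1), ‖iteratedFDeriv ℝ j g x‖) p volume :=
      (f.memLp k).norm.add
        ((memLp_finsetSum _ fun j _ => (g.memLp j).norm).const_mul _)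
    refine hbd.mono' (hs.continuous_iteratedFDeriv (m := k)
      (mod_cast le_top)).aestronglyMeasurable (Eventually.of_forall fun x => ?_)
    have hsub : iteratedFDeriv ℝ k (fun y => f (y + g y) - f y) x =
        iteratedFDeriv ℝ k (fun y => f (y + g y)) x - iteratedFDeriv ℝ k f x :=
      iteratedFDeriv_sub_apply (hs.of_le (mod_cast le_top)).contDiffAt
        (f.contDiff.of_le (mod_cast le_top)).contDiffAt
    have := h x
    rw [hsub] at this
    calc _ = ‖iteratedFDeriv ℝ k f x + (iteratedFDeriv ℝ k (fun y => f (y + g y)) x -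
          iteratedFDeriv ℝ k f x)‖ := by rw [add_sub_cancel]
      _ ≤ _ := (norm_add_le _ _).trans (add_le_add_right this _)⟩

theorem comp_apply (f g : SobolevInf d p) (x : Rd d) : comp f g x = f (x + g x) := rfl

theorem comp_zero (f : SobolevInf d p) : comp f 0 = f :=
  ext fun x => by rw [comp_apply, zero_apply, add_zero]

theorem zero_comp (g : SobolevInf d p) : comp 0 g = 0 := rfl

theorem add_comp (f f' g : SobolevInf d p) : comp (f + f') g = comp f g + comp f' g := rfl

theorem sub_comp (f f' g : SobolevInf d p) : comp (f - f') g = comp f g - comp f' g := rfl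

/-- `g ↦ f ∘ (id + g)` is Lipschitz for the norm of order `k`, on sets of functions whose
derivatives of order at most `k` are uniformly bounded. -/
theorem exists_jetNorm_comp_sub_le (k : ℕ) {R : ℝ} (hR : 0 ≤ R) :
    ∃ C : ℝ, 0 ≤ C ∧ ∀ f g h : SobolevInf d p,
      (∀ j ≤ k, ∀ x, ‖iteratedFDeriv ℝ j g x‖ ≤ R) →
      (∀ j ≤ k, ∀ x, ‖iteratedFDeriv ℝ j h x‖ ≤ R) →
      jetNorm d p k (comp f g - comp f h) ≤
        C * jetNorm d p (k + 1 + d) f * jetNorm d p k (g - h) := by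
  choose C hC0 hC using fun j : ℕ =>
    exists_norm_iteratedFDeriv_comp_id_add_sub_le (V := Rd d) j hR
  refine ⟨∑ j ∈ Finset.range (k + 1), C j * 2 ^ d,
    Finset.sum_nonneg fun j _ => mul_nonneg (hC0 j) (by positivity), fun f g h hg hh => ?_⟩
  rw [jetNorm_apply k (comp f g - comp f h), Finset.sum_mul, Finset.sum_mul]
  refine Finset.sum_le_sum fun j hj => ?_
  have hjk : j ≤ k := Nat.lt_succ_iff.1 (Finset.mem_range.1 hj)
  have h1 : SobolevInf.seminorm d p j (comp f g - comp f h) ≤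
      C j * (2 ^ d * jetNorm d p (k + 1 + d) f) * jetNorm d p j (g - h) := by
    refine seminorm_le_of_forall_norm_le (mul_nonneg (hC0 j) (by positivity)) fun x => ?_
    exact hC j (Rd d) f g h x _ f.contDiff g.contDiff h.contDiff
      (fun i hi z => norm_iteratedFDeriv_le (by omega) f z)
      (fun i hi => hg i (by omega) x) (fun i hi => hh i (by omega) x)
  calc _ ≤ _ := h1
    _ ≤ C j * (2 ^ d * jetNorm d p (k + 1 + d) f) * jetNorm d p k (g - h) := by
        have := hC0 j
        gcongr
        exact jetNorm_mono hjk _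
    _ = _ := by ring

end SobolevInf

/-! ### The Euler scheme -/

/-- Discrete Grönwall inequality for recurrences which hold for finitely many steps only. -/
theorem discrete_gronwall_range {u b c : ℕ → ℝ} {n : ℕ} (hu0 : 0 ≤ u 0) (hb : ∀ i, 0 ≤ b i)
    (hc : ∀ i, 0 ≤ c i) (hu : ∀ i < n, u (i + 1) ≤ (1 + c i) * u i + b i) :
    u n ≤ (u 0 + ∑ i ∈ Finset.range n, b i) * Real.exp (∑ i ∈ Finset.range n, c i) := by
  induction n with
  | zero => simp
  | succ n ih =>
    have h := ih fun i hi => hu i (by omega)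
    have hs : 0 ≤ u 0 + ∑ i ∈ Finset.range n, b i :=
      add_nonneg hu0 (Finset.sum_nonneg fun i _ => hb i)
    have hsc : 0 ≤ ∑ i ∈ Finset.range n, c i := Finset.sum_nonneg fun i _ => hc i
    rw [Finset.sum_range_succ, Finset.sum_range_succ, Real.exp_add]
    have h1 : 1 + c n ≤ Real.exp (c n) := by linarith [Real.add_one_le_exp (c n)]
    have h2 : 1 ≤ Real.exp (∑ i ∈ Finset.range n, c i) * Real.exp (c n) :=
      one_le_mul_of_one_le_of_one_le (Real.one_le_exp hsc) (Real.one_le_exp (hc n))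
    have := hc n
    have := hb n
    calc u (n + 1) ≤ (1 + c n) * u n + b n := hu n (by omega)
      _ ≤ (1 + c n) * ((u 0 + ∑ i ∈ Finset.range n, b i) *
          Real.exp (∑ i ∈ Finset.range n, c i)) + b n * 1 := by rw [mul_one]; gcongr
      _ ≤ Real.exp (c n) * ((u 0 + ∑ i ∈ Finset.range n, b i) *
          Real.exp (∑ i ∈ Finset.range n, c i)) +
          b n * (Real.exp (∑ i ∈ Finset.range n, c i) * Real.exp (c n)) := by gcongr
      _ = _ := by ring

theorem sum_range_le_of_le {a : ℕ → ℝ} (ha : ∀ i, 0 ≤ a i) {i n : ℕ} (h : i ≤ n) {S : ℝ}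
    (hS : ∑ j ∈ Finset.range n, a j ≤ S) : ∑ j ∈ Finset.range i, a j ≤ S :=
  (Finset.sum_le_sum_of_subset_of_nonneg (Finset.range_mono h) fun _ _ _ => ha _).trans hS

theorem sum_range_mul {M : Type*} [AddCommMonoid M] (a : ℕ → M) (n l : ℕ) :
    ∑ i ∈ Finset.range (n * l), a i =
      ∑ j ∈ Finset.range n, ∑ r ∈ Finset.range l, a (j * l + r) := by
  induction n with
  | zero => simp
  | succ n ih => rw [Finset.sum_range_succ, add_mul, one_mul, Finset.sum_range_add, ih]

namespace SobolevInf

variable {d : ℕ} {p : ℝ≥0∞} [Fact (1 ≤ p)]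

/-- The displacement of the composition `(id + f (n - 1)) ∘ ⋯ ∘ (id + f 0)`, that is, the Euler
scheme with increments `f`. -/
noncomputable def euler (f : ℕ → SobolevInf d p) : ℕ → SobolevInf d p
  | 0 => 0
  | n + 1 => euler f n + comp (f n) (euler f n)

theorem euler_succ (f : ℕ → SobolevInf d p) (n : ℕ) :
    euler f (n + 1) = euler f n + comp (f n) (euler f n) := rfl

/-- The derivatives of the Euler scheme are bounded order by order: the recurrence for the
derivatives of order `k` is affine once the lower ones are bounded. -/
theorem exists_norm_iteratedFDeriv_euler_le_of_lt (k : ℕ) (S : ℝ) :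
    ∃ R : ℝ, 0 ≤ R ∧ ∀ (f : ℕ → SobolevInf d p) (n : ℕ),
      ∑ i ∈ Finset.range n, jetNorm d p (k + d) (f i) ≤ S →
      ∀ j < k, ∀ x, ‖iteratedFDeriv ℝ j (euler f n) x‖ ≤ R := by
  induction k with
  | zero => exact ⟨0, le_rfl, fun f n _ j hj => absurd hj (Nat.not_lt_zero j)⟩
  | succ k ih =>
    obtain ⟨R, hR0, hR⟩ := ih
    obtain ⟨C, hC0, hC⟩ := exists_norm_iteratedFDeriv_comp_id_add_le_affine (V := Rd d)
      (G := Rd d) k hR0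
    refine ⟨max R (Real.exp (C * (2 ^ d * S))), le_max_of_le_left hR0, fun f n hf j hj x => ?_⟩
    have hf' : ∀ i ≤ n, ∑ l ∈ Finset.range i, jetNorm d p (k + d) (f l) ≤ S := fun i hi =>
      sum_range_le_of_le (fun _ => apply_nonneg _ _) hi
        ((Finset.sum_le_sum fun l _ => jetNorm_mono (by omega) _).trans hf)
    rcases Nat.lt_succ_iff_lt_or_eq.1 hj with hj | rfl
    · exact (hR f n (hf' n le_rfl) j hj x).trans (le_max_left _ _)
    refine le_max_of_le_right ?_
    have h := discrete_gronwall_range (u := fun i => 1 + ‖iteratedFDeriv ℝ j (euler f i) x‖)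
      (b := fun _ => 0) (c := fun i => C * (2 ^ d * jetNorm d p (j + d) (f i))) (n := n)
      (by positivity) (fun _ => le_rfl) (fun i => by positivity) (fun i hi => ?_)
    · have h0 : iteratedFDeriv ℝ j (euler f 0) x = 0 := iteratedFDeriv_zero j x
      simp only [h0, norm_zero, add_zero, Finset.sum_const_zero, one_mul,
        ← Finset.mul_sum] at h
      refine (le_add_of_nonneg_left zero_le_one).trans (h.trans ?_)
      gcongr
      exact hf' n le_rfl
    · have h1 := hC (f i) (euler f i) x (2 ^ d * jetNorm d p (j + d) (f i)) (f i).contDiff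
        (euler f i).contDiff (fun l hl => norm_iteratedFDeriv_le hl _ _)
        (fun l hl => hR f i (hf' i hi.le) l hl x)
      rw [euler_succ, iteratedFDeriv_add]
      have h2 := norm_add_le (iteratedFDeriv ℝ j (euler f i) x)
        (iteratedFDeriv ℝ j (comp (f i) (euler f i)) x)
      have h3 : ‖iteratedFDeriv ℝ j (comp (f i) (euler f i)) x‖ ≤ _ := h1
      linarith

theorem exists_norm_iteratedFDeriv_euler_le (k : ℕ) (S : ℝ) :
    ∃ R : ℝ, 0 ≤ R ∧ ∀ (f : ℕ → SobolevInf d p) (n : ℕ),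
      ∑ i ∈ Finset.range n, jetNorm d p (k + 1 + d) (f i) ≤ S →
      ∀ j ≤ k, ∀ x, ‖iteratedFDeriv ℝ j (euler f n) x‖ ≤ R := by
  obtain ⟨R, hR0, hR⟩ := exists_norm_iteratedFDeriv_euler_le_of_lt (p := p) (k + 1) S
  exact ⟨R, hR0, fun f n hf j hj => hR f n hf j (Nat.lt_succ_iff.2 hj)⟩

/-- A constant `C` which controls the composition with all Euler schemes whose increments have
total norm at most `S`. -/
theorem exists_jetNorm_comp_euler_le (k : ℕ) {S : ℝ} (hS : 0 ≤ S) :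
    ∃ C : ℝ, 0 ≤ C ∧ ∀ (f : ℕ → SobolevInf d p) (n : ℕ),
      ∑ i ∈ Finset.range n, jetNorm d p (k + 1 + d) (f i) ≤ S →
      (∀ h, jetNorm d p k (comp h (euler f n)) ≤ C * jetNorm d p (k + 1 + d) h) ∧
      ∀ (g : ℕ → SobolevInf d p) (m : ℕ),
      ∑ i ∈ Finset.range m, jetNorm d p (k + 1 + d) (g i) ≤ S →
      ∀ h, jetNorm d p k (comp h (euler f n) - comp h (euler g m)) ≤
        C * jetNorm d p (k + 1 + d) h * jetNorm d p k (euler f n - euler g m) := by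
  obtain ⟨R, hR0, hR⟩ := exists_norm_iteratedFDeriv_euler_le (d := d) (p := p) k S
  obtain ⟨C, hC0, hC⟩ := exists_jetNorm_comp_sub_le (d := d) (p := p) k hR0
  have hlin : ∀ (f : ℕ → SobolevInf d p) (n : ℕ),
      ∑ i ∈ Finset.range n, jetNorm d p (k + 1 + d) (f i) ≤ S → ∀ h,
      jetNorm d p k (comp h (euler f n)) ≤
        (1 + C * jetNorm d p k (euler f n)) * jetNorm d p (k + 1 + d) h := by
    intro f n hf h
    have h1 := hC h (euler f n) 0 (hR f n hf)
      (fun j _ x => by rw [iteratedFDeriv_zero, norm_zero]; exact hR0)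
    rw [comp_zero, sub_zero] at h1
    have h2 : jetNorm d p k (comp h (euler f n)) ≤
        jetNorm d p k h + jetNorm d p k (comp h (euler f n) - h) := by
      have := map_add_le_add (jetNorm d p k) h (comp h (euler f n) - h)
      rwa [add_sub_cancel] at this
    have h3 := jetNorm_mono (show k ≤ k + 1 + d by omega) h
    linarith
  have hbd : ∀ (f : ℕ → SobolevInf d p) (n : ℕ),
      ∑ i ∈ Finset.range n, jetNorm d p (k + 1 + d) (f i) ≤ S →
      jetNorm d p k (euler f n) ≤ S * Real.exp (C * S) := by
    intro f n hf
    have h := discrete_gronwall_range (u := fun i => jetNorm d p k (euler f i))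
      (b := fun i => jetNorm d p (k + 1 + d) (f i))
      (c := fun i => C * jetNorm d p (k + 1 + d) (f i)) (n := n)
      (apply_nonneg _ _) (fun _ => apply_nonneg _ _) (fun i => by positivity) (fun i hi => ?_)
    · have h0 : jetNorm d p k (euler f 0) = 0 := map_zero _
      simp only [h0, zero_add, ← Finset.mul_sum] at h
      refine h.trans ?_
      gcongr
    · have h1 := hlin f i (sum_range_le_of_le (fun _ => apply_nonneg _ _) hi.le hf) (f i)
      have h2 := map_add_le_add (jetNorm d p k) (euler f i) (comp (f i) (euler f i))
      rw [euler_succ]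
      linarith
  have hE : 0 ≤ S * Real.exp (C * S) := by positivity
  refine ⟨1 + C * (S * Real.exp (C * S)) + C, by positivity, fun f n hf => ⟨fun h => ?_,
    fun g m hg h => ?_⟩⟩
  · refine (hlin f n hf h).trans ?_
    have : C * jetNorm d p k (euler f n) ≤ C * (S * Real.exp (C * S)) := by
      gcongr
      exact hbd f n hf
    exact mul_le_mul_of_nonneg_right (by linarith) (apply_nonneg _ _)
  · refine (hC h _ _ (hR f n hf) (hR g m hg)).trans ?_
    gcongr
    have : 0 ≤ C * (S * Real.exp (C * S)) := by positivity
    linarith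

/-- The Euler scheme is Lipschitz in its increments. -/
theorem exists_jetNorm_euler_sub_le (k : ℕ) {S : ℝ} (hS : 0 ≤ S) :
    ∃ C : ℝ, 0 ≤ C ∧ ∀ (f g : ℕ → SobolevInf d p) (n : ℕ),
      ∑ i ∈ Finset.range n, jetNorm d p (k + 1 + d) (f i) ≤ S →
      ∑ i ∈ Finset.range n, jetNorm d p (k + 1 + d) (g i) ≤ S →
      jetNorm d p k (euler f n - euler g n) ≤
        C * ∑ i ∈ Finset.range n, jetNorm d p (k + 1 + d) (f i - g i) := by
  obtain ⟨C, hC0, hC⟩ := exists_jetNorm_comp_euler_le (d := d) (p := p) k hS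
  refine ⟨C * Real.exp (C * S), by positivity, fun f g n hf hg => ?_⟩
  have h := discrete_gronwall_range (u := fun i => jetNorm d p k (euler f i - euler g i))
    (b := fun i => C * jetNorm d p (k + 1 + d) (f i - g i))
    (c := fun i => C * jetNorm d p (k + 1 + d) (g i)) (n := n)
    (apply_nonneg _ _) (fun _ => by positivity) (fun i => by positivity) (fun i hi => ?_)
  · have h0 : jetNorm d p k (euler f 0 - euler g 0) = 0 := by
      rw [show euler f 0 - euler g 0 = (0 : SobolevInf d p) from sub_self _, map_zero]
    simp only [h0, zero_add, ← Finset.mul_sum] at h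
    refine h.trans ?_
    calc _ ≤ C * ∑ i ∈ Finset.range n, jetNorm d p (k + 1 + d) (f i - g i) *
          Real.exp (C * S) := by
          rw [← Finset.sum_mul, ← mul_assoc]
          gcongr
      _ = _ := by rw [← Finset.sum_mul]; ring
  · have hfi := sum_range_le_of_le (fun _ => apply_nonneg _ _) hi.le hf
    have hgi := sum_range_le_of_le (fun _ => apply_nonneg _ _) hi.le hg
    have h1 := (hC f i hfi).1 (f i - g i)
    have h2 := (hC f i hfi).2 g i hgi (g i)
    have e : euler f (i + 1) - euler g (i + 1) = (euler f i - euler g i) +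
        (comp (f i - g i) (euler f i) +
          (comp (g i) (euler f i) - comp (g i) (euler g i))) := by
      rw [euler_succ, euler_succ, sub_comp]; abel
    rw [e]
    have h3 := map_add_le_add (jetNorm d p k) (euler f i - euler g i)
      (comp (f i - g i) (euler f i) + (comp (g i) (euler f i) - comp (g i) (euler g i)))
    have h4 := map_add_le_add (jetNorm d p k) (comp (f i - g i) (euler f i))
      (comp (g i) (euler f i) - comp (g i) (euler g i))
    linarith

/-- Merging blocks of `l` successive increments changes the Euler scheme by at most a multiple of
the largest total norm of a block: within a block the two schemes differ to second order only. -/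
theorem exists_jetNorm_euler_sub_euler_block_le (k : ℕ) {S : ℝ} (hS : 0 ≤ S) :
    ∃ C : ℝ, 0 ≤ C ∧ ∀ (f : ℕ → SobolevInf d p) (n l : ℕ) (δ : ℝ), 0 ≤ δ →
      ∑ i ∈ Finset.range (n * l), jetNorm d p (k + 1 + d) (f i) ≤ S →
      (∀ j < n, ∑ r ∈ Finset.range l, jetNorm d p (k + 1 + d) (f (j * l + r)) ≤ δ) →
      jetNorm d p k (euler f (n * l) -
        euler (fun j => ∑ r ∈ Finset.range l, f (j * l + r)) n) ≤ C * δ := by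
  obtain ⟨C, hC0, hC⟩ := exists_jetNorm_comp_euler_le (d := d) (p := p) k hS
  refine ⟨C * C * S * Real.exp (C * S), by positivity, fun f n l δ hδ hf hblock => ?_⟩
  set F : ℕ → SobolevInf d p := fun j => ∑ r ∈ Finset.range l, f (j * l + r) with hF
  set s : ℕ → ℝ := fun j => ∑ r ∈ Finset.range l, jetNorm d p (k + 1 + d) (f (j * l + r)) with hs
  have hs0 : ∀ j, 0 ≤ s j := fun j => Finset.sum_nonneg fun _ _ => apply_nonneg _ _
  have hFs : ∀ j, jetNorm d p (k + 1 + d) (F j) ≤ s j := fun j =>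
    Finset.le_sum_of_subadditive _ (map_zero _).le (map_add_le_add _) _ _
  have hsS : ∑ j ∈ Finset.range n, s j ≤ S :=
    (sum_range_mul (fun i => jetNorm d p (k + 1 + d) (f i)) n l).symm.trans_le hf
  have hfS : ∀ i ≤ n * l, ∑ q ∈ Finset.range i, jetNorm d p (k + 1 + d) (f q) ≤ S := fun i hi =>
    sum_range_le_of_le (fun _ => apply_nonneg _ _) hi hf
  have hFS : ∀ j ≤ n, ∑ q ∈ Finset.range j, jetNorm d p (k + 1 + d) (F q) ≤ S := fun j hj =>
    sum_range_le_of_le (fun _ => apply_nonneg _ _) hj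
      ((Finset.sum_le_sum fun j _ => hFs j).trans hsS)
  -- the scheme moves by a multiple of `s j` only within block `j`
  have hmove : ∀ j < n, ∀ r ≤ l,
      jetNorm d p k (euler f (j * l + r) - euler f (j * l)) ≤ C * s j := by
    intro j hj r hr
    have : ∀ r ≤ l, jetNorm d p k (euler f (j * l + r) - euler f (j * l)) ≤
        C * ∑ q ∈ Finset.range r, jetNorm d p (k + 1 + d) (f (j * l + q)) := by
      intro r
      induction r with
      | zero => intro _; simp
      | succ r ih =>
        intro hr
        have hidx : j * l + r ≤ n * l := by nlinarith
        have h1 := (hC f (j * l + r) (hfS _ hidx)).1 (f (j * l + r))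
        have e : euler f (j * l + (r + 1)) - euler f (j * l) =
            (euler f (j * l + r) - euler f (j * l)) +
              comp (f (j * l + r)) (euler f (j * l + r)) := by
          rw [← add_assoc, euler_succ]; abel
        have h2 := map_add_le_add (jetNorm d p k) (euler f (j * l + r) - euler f (j * l))
          (comp (f (j * l + r)) (euler f (j * l + r)))
        rw [e, Finset.sum_range_succ, mul_add]
        linarith [ih (by omega)]
    refine (this r hr).trans ?_
    gcongr
    exact Finset.sum_le_sum_of_subset_of_nonneg (Finset.range_mono hr)
      fun _ _ _ => apply_nonneg _ _
  have hstep : ∀ j < n, jetNorm d p k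
      (euler f (j * l + l) - euler f (j * l) - comp (F j) (euler f (j * l))) ≤
        C * C * s j * s j := by
    intro j hj
    have : ∀ r ≤ l, jetNorm d p k (euler f (j * l + r) - euler f (j * l) -
        comp (∑ q ∈ Finset.range r, f (j * l + q)) (euler f (j * l))) ≤
        C * (C * s j) * ∑ q ∈ Finset.range r, jetNorm d p (k + 1 + d) (f (j * l + q)) := by
      intro r
      induction r with
      | zero => intro _; simp [zero_comp]
      | succ r ih =>
        intro hr
        have hidx : j * l + r ≤ n * l := by nlinarith
        have h1 := (hC f (j * l + r) (hfS _ hidx)).2 f (j * l) (hfS _ (by omega)) (f (j * l + r))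
        have h1' : jetNorm d p k (comp (f (j * l + r)) (euler f (j * l + r)) -
            comp (f (j * l + r)) (euler f (j * l))) ≤
            C * jetNorm d p (k + 1 + d) (f (j * l + r)) * (C * s j) := by
          refine h1.trans ?_
          gcongr
          exact hmove j hj r (by omega)
        have e : euler f (j * l + (r + 1)) - euler f (j * l) -
            comp (∑ q ∈ Finset.range (r + 1), f (j * l + q)) (euler f (j * l)) =
            (euler f (j * l + r) - euler f (j * l) -
              comp (∑ q ∈ Finset.range r, f (j * l + q)) (euler f (j * l))) +
            (comp (f (j * l + r)) (euler f (j * l + r)) -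
              comp (f (j * l + r)) (euler f (j * l))) := by
          rw [← add_assoc, euler_succ, Finset.sum_range_succ, add_comp]; abel
        rw [e, Finset.sum_range_succ, mul_add]
        refine (map_add_le_add _ _ _).trans (add_le_add (ih (by omega)) (h1'.trans ?_))
        exact le_of_eq (by ring)
    refine (this l le_rfl).trans (le_of_eq ?_)
    ring
  have h := discrete_gronwall_range
    (u := fun j => jetNorm d p k (euler f (j * l) - euler F j))
    (b := fun j => C * C * s j * s j) (c := fun j => C * s j) (n := n)
    (apply_nonneg _ _) (fun j => by have := hs0 j; positivity)
    (fun j => mul_nonneg hC0 (hs0 j)) (fun j hj => ?_)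
  · have h0 : jetNorm d p k (euler f (0 * l) - euler F 0) = 0 := by
      rw [zero_mul, show euler f 0 - euler F 0 = (0 : SobolevInf d p) from sub_self _, map_zero]
    simp only [h0, zero_add, ← Finset.mul_sum] at h
    refine h.trans ?_
    have h1 : ∑ j ∈ Finset.range n, C * C * s j * s j ≤ C * C * S * δ := by
      calc ∑ j ∈ Finset.range n, C * C * s j * s j
          ≤ ∑ j ∈ Finset.range n, C * C * s j * δ := by
            refine Finset.sum_le_sum fun j hj => ?_
            have := hs0 j
            gcongr
            exact hblock j (Finset.mem_range.1 hj)
        _ = C * C * (∑ j ∈ Finset.range n, s j) * δ := by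
            rw [Finset.mul_sum, Finset.sum_mul]
        _ ≤ _ := by gcongr
    calc _ ≤ C * C * S * δ * Real.exp (C * S) := by gcongr
      _ = _ := by ring
  · have hidx : j * l ≤ n * l := Nat.mul_le_mul_right l hj.le
    have h1 := (hC f (j * l) (hfS _ hidx)).2 F j (hFS j hj.le) (F j)
    have h1' : jetNorm d p k (comp (F j) (euler f (j * l)) - comp (F j) (euler F j)) ≤
        C * s j * jetNorm d p k (euler f (j * l) - euler F j) := by
      refine h1.trans ?_
      gcongr
      exact hFs j
    have e : euler f ((j + 1) * l) - euler F (j + 1) = (euler f (j * l) - euler F j) +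
        ((euler f (j * l + l) - euler f (j * l) - comp (F j) (euler f (j * l))) +
          (comp (F j) (euler f (j * l)) - comp (F j) (euler F j))) := by
      rw [add_mul, one_mul, euler_succ]; abel
    have h3 := map_add_le_add (jetNorm d p k) (euler f (j * l) - euler F j)
      ((euler f (j * l + l) - euler f (j * l) - comp (F j) (euler f (j * l))) +
          (comp (F j) (euler f (j * l)) - comp (F j) (euler F j)))
    have h4 := map_add_le_add (jetNorm d p k)
      (euler f (j * l + l) - euler f (j * l) - comp (F j) (euler f (j * l)))
      (comp (F j) (euler f (j * l)) - comp (F j) (euler F j))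
    rw [e]
    linarith [hstep j hj]

end SobolevInf

/-! ### Completeness of `W^{∞,p}` -/

namespace SobolevInf

variable {d : ℕ} {p : ℝ≥0∞} [Fact (1 ≤ p)]

/-- `W^{∞,p}` is sequentially complete: by the Sobolev inequality all derivatives converge
uniformly, and Fatou's lemma gives convergence in `L^p`. -/
theorem exists_tendsto_of_cauchy (f : ℕ → SobolevInf d p)
    (hf : ∀ k, ∀ ε > 0, ∃ N, ∀ m ≥ N, ∀ n ≥ N, jetNorm d p k (f m - f n) ≤ ε) :
    ∃ g : SobolevInf d p, ∀ k, Tendsto (fun n => jetNorm d p k (f n - g)) atTop (𝓝 0) := by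
  have hunif : ∀ k, UniformCauchySeqOn (fun n x => iteratedFDeriv ℝ k (f n) x) atTop
      Set.univ := by
    intro k
    rw [Metric.uniformCauchySeqOn_iff]
    intro ε hε
    obtain ⟨N, hN⟩ := hf (k + d) (ε / 2 / 2 ^ d) (by positivity)
    refine ⟨N, fun m hm n hn x _ => ?_⟩
    rw [dist_eq_norm, ← iteratedFDeriv_sub]
    calc _ ≤ 2 ^ d * jetNorm d p (k + d) (f m - f n) := norm_iteratedFDeriv_le le_rfl _ _
      _ ≤ 2 ^ d * (ε / 2 / 2 ^ d) := by gcongr; exact hN m hm n hn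
      _ = ε / 2 := by field_simp
      _ < ε := half_lt_self hε
  have hlim : ∀ (x : Rd d) (k : ℕ), ∃ z, Tendsto (fun n => iteratedFDeriv ℝ k (f n) x) atTop
      (𝓝 z) := fun x k =>
    cauchySeq_tendsto_of_complete ((hunif k).cauchySeq (Set.mem_univ x))
  obtain ⟨q, hq⟩ : ∃ q : Rd d → FormalMultilinearSeries ℝ (Rd d) (Rd d), ∀ x k,
      Tendsto (fun n => iteratedFDeriv ℝ k (f n) x) atTop (𝓝 (q x k)) := by
    choose q hq using hlim
    exact ⟨q, hq⟩
  have hqu : ∀ k, TendstoUniformly (fun n x => iteratedFDeriv ℝ k (f n) x)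
      (fun x => q x k) atTop := fun k =>
    tendstoUniformlyOn_univ.1 ((hunif k).tendstoUniformlyOn_of_tendsto fun x _ => hq x k)
  have htaylor : HasFTaylorSeriesUpTo ∞ (fun x => (q x 0).curry0) q := by
    refine (hasFTaylorSeriesUpTo_top_iff' le_rfl).2 ⟨fun _ => rfl, fun m x => ?_⟩
    refine hasFDerivAt_of_tendstoUniformly (l := atTop)
      (f := fun n x => iteratedFDeriv ℝ m (f n) x)
      (f' := fun n x => (iteratedFDeriv ℝ (m + 1) (f n) x).curryLeft)
      (g' := fun x => (q x (m + 1)).curryLeft) ?_ ?_ (fun y => hq y m) x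
    · exact (continuousMultilinearCurryLeftEquiv ℝ (fun _ : Fin (m + 1) => Rd d)
        (Rd d)).isometry.uniformContinuous.comp_tendstoUniformly (hqu (m + 1))
    · intro n y
      exact (f n).contDiff.ftaylorSeries.fderiv m (mod_cast ENat.natCast_lt_top m) y
  have heq : ∀ k x, iteratedFDeriv ℝ k (fun x => (q x 0).curry0) x = q x k := fun k x =>
    (htaylor.eq_iteratedFDeriv (mod_cast le_top) x).symm
  have hcd : ContDiff ℝ ∞ fun x => (q x 0).curry0 := htaylor.contDiff
  have hbd : ∀ k, ∀ ε > 0, ∃ N, ∀ n ≥ N,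
      eLpNorm (fun x => iteratedFDeriv ℝ k (f n) x - q x k) p volume ≤ ENNReal.ofReal ε := by
    intro k ε hε
    obtain ⟨N, hN⟩ := hf k ε hε
    refine ⟨N, fun n hn => ?_⟩
    refine Lp.eLpNorm_le_of_ae_tendsto (u := atTop)
      (f := fun m x => iteratedFDeriv ℝ k (f n) x - iteratedFDeriv ℝ k (f m) x) ?_ ?_ ?_
    · filter_upwards [eventually_ge_atTop N] with m hm
      have h1 : (fun x => iteratedFDeriv ℝ k (f n) x - iteratedFDeriv ℝ k (f m) x) =
          iteratedFDeriv ℝ k (f n - f m : SobolevInf d p) :=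
        funext fun x => (iteratedFDeriv_sub _ _ _ _).symm
      rw [h1, ← ofReal_seminorm]
      exact ENNReal.ofReal_le_ofReal ((seminorm_le_jetNorm le_rfl _).trans (hN n hn m hm))
    · exact fun m => (((f n).memLp k).sub ((f m).memLp k)).1
    · exact Eventually.of_forall fun x => (hq x k).const_sub _
  have hmem : ∀ k, MemLp (iteratedFDeriv ℝ k fun x => (q x 0).curry0) p volume := by
    intro k
    obtain ⟨N, hN⟩ := hbd k 1 one_pos
    have hmeas : AEStronglyMeasurable (fun x => q x k) (volume : Measure (Rd d)) := by
      have := (hcd.continuous_iteratedFDeriv (m := k) (mod_cast le_top)).aestronglyMeasurable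
        (μ := volume)
      rwa [show iteratedFDeriv ℝ k (fun x => (q x 0).curry0) = fun x => q x k from
        funext (heq k)] at this
    have h1 : MemLp (fun x => iteratedFDeriv ℝ k (f N) x - q x k) p volume :=
      ⟨((f N).memLp k).1.sub hmeas, (hN N le_rfl).trans_lt ENNReal.ofReal_lt_top⟩
    have h2 := ((f N).memLp k).sub h1
    refine (memLp_congr_ae (Eventually.of_forall fun x => ?_)).1 h2
    exact (sub_sub_cancel _ _).trans (heq k x).symm
  let g : SobolevInf d p := ⟨_, hcd, hmem⟩
  refine ⟨g, fun k => ?_⟩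
  have hsem : ∀ k, Tendsto (fun n => SobolevInf.seminorm d p k (f n - g)) atTop (𝓝 0) := by
    intro k
    rw [Metric.tendsto_atTop]
    intro ε hε
    obtain ⟨N, hN⟩ := hbd k (ε / 2) (half_pos hε)
    refine ⟨N, fun n hn => ?_⟩
    rw [Real.dist_eq, sub_zero, abs_of_nonneg (apply_nonneg _ _), seminorm_apply]
    have h1 : iteratedFDeriv ℝ k (f n - g : SobolevInf d p) =
        fun x => iteratedFDeriv ℝ k (f n) x - q x k := by
      funext x
      rw [iteratedFDeriv_sub]
      exact congrArg _ (heq k x)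
    rw [h1]
    exact (ENNReal.toReal_le_of_le_ofReal (half_pos hε).le (hN n hn)).trans_lt (half_lt_self hε)
  simp only [jetNorm_apply]
  have := tendsto_finsetSum (Finset.range (k + 1)) fun j _ => hsem j
  simpa using this

end SobolevInf

/-! ### Integrals of functions integrable by seminorm -/

section SimpleIntegral

variable {E : Type*} [AddCommGroup E] [Module ℝ E]

theorem simpleIntegral_eq_setIntegral {G : Type*} [NormedAddCommGroup G] [NormedSpace ℝ G]
    [CompleteSpace G] (r : SimpleFunc I G) (J : Set I) :
    simpleIntegral r J = ∫ t in J, r t := by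
  rw [SimpleFunc.integral_eq_sum _ (SimpleFunc.integrable_of_isFiniteMeasure r)]
  refine Finset.sum_congr rfl fun y _ => ?_
  rw [measureReal_restrict_apply (r.measurableSet_fiber y)]

theorem map_simpleIntegral {G : Type*} [NormedAddCommGroup G] [NormedSpace ℝ G]
    [CompleteSpace G] (ℓ : E →ₗ[ℝ] G) (r : SimpleFunc I E) {J : Set I} (hJ : MeasurableSet J) :
    ℓ (simpleIntegral r J) = ∫ t in J, ℓ (r t) := by
  have h := simpleIntegral_eq_setIntegral (r.map ℓ) J
  rw [simpleIntegral_map _ _ hJ] at h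
  refine Eq.trans ?_ h
  simp [simpleIntegral, map_sum]

theorem Seminorm.simpleIntegral_le (q : Seminorm ℝ E) (r : SimpleFunc I E) {J : Set I}
    (hJ : MeasurableSet J) : q (simpleIntegral r J) ≤ ∫ t in J, q (r t) := by
  have h := simpleIntegral_eq_setIntegral (r.map q) J
  rw [simpleIntegral_map _ _ hJ] at h
  refine le_trans ?_ (le_of_eq h)
  refine (Finset.le_sum_of_subadditive q (map_zero q).le (map_add_le_add q) _ _).trans
    (le_of_eq (Finset.sum_congr rfl fun y _ => ?_))
  rw [map_smul_eq_mul, Real.norm_of_nonneg measureReal_nonneg, smul_eq_mul]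

theorem simpleIntegral_sub (s r : SimpleFunc I E) {J : Set I} (hJ : MeasurableSet J) :
    simpleIntegral (s - r) J = simpleIntegral s J - simpleIntegral r J := by
  have h1 : s - r = (s.pair r).map (fun z : E × E => z.1 - z.2) := rfl
  have h2 : simpleIntegral s J = simpleIntegral ((s.pair r).map Prod.fst) J := rfl
  have h3 : simpleIntegral r J = simpleIntegral ((s.pair r).map Prod.snd) J := rfl
  rw [h1, h2, h3, simpleIntegral_map _ _ hJ, simpleIntegral_map _ _ hJ,
    simpleIntegral_map _ _ hJ, ← Finset.sum_sub_distrib]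
  simp only [smul_sub]

variable [TopologicalSpace E]

/-- Simple functions are dense for each seminorm `f ↦ ∫ q (f t) dt`: almost everywhere convergent
simple functions converge in this seminorm once they are cut off where `q` exceeds
`2 * q (f t)`. -/
theorem IntegrableBySeminorm.exists_simpleFunc_integral_lt {f : I → E}
    (hf : IntegrableBySeminorm f) {q : Seminorm ℝ E} (hq : Continuous q) {ε : ℝ} (hε : 0 < ε) :
    ∃ r : SimpleFunc I E, Integrable (fun t => q (r t - f t)) volume ∧
      ∫ t, q (r t - f t) < ε := by
  have hint := hf.integrable_seminorm hq
  obtain ⟨s, hs, -⟩ := hf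
  have happ := (hs q hq).1
  set h : I → ℝ := hint.1.mk _ with hh
  have hhm : Measurable h := hint.1.stronglyMeasurable_mk.measurable
  have hhe : ∀ᵐ t, q (f t) = h t := hint.1.ae_eq_mk
  have hA : ∀ n, MeasurableSet {t | q (s q n t) ≤ 2 * h t} := fun n =>
    measurableSet_le ((s q n).map q).measurable (hhm.const_mul 2)
  let r : ℕ → SimpleFunc I E := fun n => SimpleFunc.piecewise _ (hA n) (s q n) 0
  have hr1 : ∀ n t, q (s q n t) ≤ 2 * h t → r n t = s q n t := fun n t ht => by
    simp only [r, SimpleFunc.coe_piecewise]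
    exact Set.piecewise_eq_of_mem _ _ _ ht
  have hr2 : ∀ n t, ¬ q (s q n t) ≤ 2 * h t → r n t = 0 := fun n t ht => by
    simp only [r, SimpleFunc.coe_piecewise]
    exact Set.piecewise_eq_of_notMem _ _ _ ht
  have hbound : ∀ n, ∀ᵐ t, ‖q (r n t - f t)‖ ≤ 3 * q (f t) := by
    intro n
    filter_upwards [hhe] with t ht
    rw [Real.norm_of_nonneg (apply_nonneg _ _)]
    have h1 := map_sub_le_add q (r n t) (f t)
    have h0 := apply_nonneg q (f t)
    by_cases hc : q (s q n t) ≤ 2 * h t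
    · rw [hr1 n t hc] at h1 ⊢
      linarith
    · rw [hr2 n t hc] at h1 ⊢
      rw [map_zero] at h1
      linarith
  have hlim : ∀ᵐ t, Tendsto (fun n => q (r n t - f t)) atTop (𝓝 0) := by
    filter_upwards [hhe, happ] with t ht hst
    rcases (apply_nonneg q (f t)).eq_or_lt with h0 | h0
    · refine squeeze_zero (fun _ => apply_nonneg q _) (fun n => ?_) hst
      by_cases hc : q (s q n t) ≤ 2 * h t
      · rw [hr1 n t hc]
      · rw [hr2 n t hc, zero_sub, map_neg_eq_map, ← h0]
        exact apply_nonneg _ _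
    · refine hst.congr' ?_
      filter_upwards [hst.eventually_lt_const h0] with n hn
      rw [hr1 n t]
      have := map_add_le_add q (s q n t - f t) (f t)
      rw [sub_add_cancel] at this
      linarith
  have hmeas : ∀ n, AEStronglyMeasurable (fun t => q (r n t - f t)) volume := fun n =>
    happ.aestronglyMeasurable (r n)
  have hconv := tendsto_integral_of_dominated_convergence (fun t => 3 * q (f t)) hmeas
    (hint.const_mul 3) hbound hlim
  rw [integral_zero] at hconv
  obtain ⟨n, hn⟩ := (hconv.eventually_lt_const hε).exists
  exact ⟨r n, (hint.const_mul 3).mono' (hmeas n) (hbound n), hn⟩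

end SimpleIntegral

namespace PreL1

open SobolevInf

variable {d : ℕ} {p : ℝ≥0∞} [Fact (1 ≤ p)]

theorem integrable_jetNorm (u : PreL1 (SobolevInf d p)) (k : ℕ) :
    Integrable (fun t => jetNorm d p k (u t)) volume :=
  u.2.integrable_seminorm (continuous_jetNorm k)

theorem integrable_apply (u : PreL1 (SobolevInf d p)) {y : I → Rd d} (hy : Continuous y) :
    Integrable (fun t => u t (y t)) volume := by
  have hbd : ∀ (f : SobolevInf d p) (x : Rd d), ‖f x‖ ≤ 2 ^ d * jetNorm d p d f :=
    fun f x => norm_apply_le f x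
  refine ((u.integrable_jetNorm d).const_mul (2 ^ d)).mono' ?_
    (Eventually.of_forall fun t => hbd _ _)
  obtain ⟨s, hs, -⟩ := u.2
  refine aestronglyMeasurable_of_tendsto_ae (u := atTop)
    (f := fun n t => (s (jetNorm d p d) n t) (y t)) (fun n => ?_) ?_
  · exact ((s (jetNorm d p d) n).measurable_bind (fun f t => f (y t)) fun f =>
      (f.contDiff.continuous.comp hy).measurable).aestronglyMeasurable
  · filter_upwards [(hs _ (continuous_jetNorm d)).1] with t ht
    rw [tendsto_iff_norm_sub_tendsto_zero]
    refine squeeze_zero (fun _ => norm_nonneg _) (fun n => hbd (s (jetNorm d p d) n t - u t) (y t))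
      ?_
    simpa using ht.const_mul (2 ^ d)

/-- The integral of a function integrable by seminorm exists in `W^{∞,p}`, as limit of the integrals
of simple functions which approximate better and better in stronger and stronger norms. -/
theorem exists_setIntegral (u : PreL1 (SobolevInf d p)) {J : Set I} (hJ : MeasurableSet J) :
    ∃ F : SobolevInf d p, (∀ x, F x = ∫ t in J, u t x) ∧
      ∀ k, jetNorm d p k F ≤ ∫ t in J, jetNorm d p k (u t) := by
  have happ : ∀ m : ℕ, ∃ r : SimpleFunc I (SobolevInf d p),
      Integrable (fun t => jetNorm d p m (r t - u t)) volume ∧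
      ∫ t, jetNorm d p m (r t - u t) < 1 / ((m : ℝ) + 1) := fun m =>
    u.2.exists_simpleFunc_integral_lt (continuous_jetNorm m) Nat.one_div_pos_of_nat
  choose r _ hr using happ
  have hru : ∀ k m, Integrable (fun t => jetNorm d p k (r m t - u t)) volume := by
    intro k m
    obtain ⟨s, hs, -⟩ := u.2
    refine Integrable.mono' (((SimpleFunc.integrable_of_isFiniteMeasure
      ((r m).map (jetNorm d p k))).add (u.integrable_jetNorm k)))
      ((hs _ (continuous_jetNorm k)).1.aestronglyMeasurable (r m))
      (Eventually.of_forall fun t => ?_)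
    rw [Real.norm_of_nonneg (apply_nonneg _ _)]
    exact map_sub_le_add _ _ _
  have hr' : ∀ k m, k ≤ m → ∫ t in J, jetNorm d p k (r m t - u t) ≤ 1 / ((m : ℝ) + 1) := by
    intro k m hkm
    refine (setIntegral_le_integral (hru k m)
      (Eventually.of_forall fun t => apply_nonneg _ _)).trans (le_trans ?_ (hr m).le)
    exact integral_mono (hru k m) (hru m m) fun t => jetNorm_mono hkm _
  have hone : ∀ ε : ℝ, 0 < ε → ∃ N : ℕ, ∀ m ≥ N, 1 / ((m : ℝ) + 1) < ε := by
    intro ε hε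
    obtain ⟨N, hN⟩ := exists_nat_one_div_lt hε
    exact ⟨N, fun m hm => (Nat.one_div_le_one_div hm).trans_lt hN⟩
  obtain ⟨F, hF⟩ := exists_tendsto_of_cauchy (fun m => simpleIntegral (r m) J) (by
    intro k ε hε
    obtain ⟨N, hN⟩ := hone (ε / 2) (half_pos hε)
    refine ⟨max N k, fun m hm n hn => ?_⟩
    rw [← simpleIntegral_sub _ _ hJ]
    refine (Seminorm.simpleIntegral_le _ _ hJ).trans ?_
    calc ∫ t in J, jetNorm d p k ((r m - r n) t)
        ≤ ∫ t in J, (jetNorm d p k (r m t - u t) + jetNorm d p k (r n t - u t)) := by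
          refine integral_mono_of_nonneg (Eventually.of_forall fun t => apply_nonneg _ _)
            ((hru k m).add (hru k n)).integrableOn (Eventually.of_forall fun t => ?_)
          have := map_sub_le_add (jetNorm d p k) (r m t - u t) (r n t - u t)
          rwa [sub_sub_sub_cancel_right] at this
      _ = (∫ t in J, jetNorm d p k (r m t - u t)) + ∫ t in J, jetNorm d p k (r n t - u t) :=
          integral_add (hru k m).integrableOn (hru k n).integrableOn
      _ ≤ ε / 2 + ε / 2 := add_le_add
          ((hr' k m (le_of_max_le_right hm)).trans (hN m (le_of_max_le_left hm)).le)
          ((hr' k n (le_of_max_le_right hn)).trans (hN n (le_of_max_le_left hn)).le)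
      _ = ε := add_halves ε)
  have hzero : Tendsto (fun m : ℕ => 1 / ((m : ℝ) + 1)) atTop (𝓝 0) :=
    tendsto_one_div_add_atTop_nhds_zero_nat
  refine ⟨F, fun x => ?_, fun k => ?_⟩
  · have h1 : Tendsto (fun m => simpleIntegral (r m) J x) atTop (𝓝 (F x)) := by
      rw [tendsto_iff_norm_sub_tendsto_zero]
      refine squeeze_zero (fun _ => norm_nonneg _)
        (fun m => norm_apply_le (simpleIntegral (r m) J - F) x) ?_
      simpa using (hF d).const_mul (2 ^ d)
    refine tendsto_nhds_unique h1 ?_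
    rw [tendsto_iff_norm_sub_tendsto_zero]
    have hux := u.integrable_apply (continuous_const (y := x))
    have hrx : ∀ m, Integrable (fun t => r m t x) volume := fun m =>
      SimpleFunc.integrable_of_isFiniteMeasure ((r m).map fun f : SobolevInf d p => f x)
    refine squeeze_zero' (Eventually.of_forall fun _ => norm_nonneg _) ?_
      (by simpa only [mul_zero] using hzero.const_mul ((2 : ℝ) ^ d))
    filter_upwards [eventually_ge_atTop d] with m hm
    have h2 : simpleIntegral (r m) J x = ∫ t in J, r m t x := map_simpleIntegral (eval x) (r m) hJ
    rw [h2, ← integral_sub (hrx m).integrableOn hux.integrableOn]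
    calc ‖∫ t in J, (r m t x - u t x)‖ ≤ ∫ t in J, 2 ^ d * jetNorm d p d (r m t - u t) := by
          refine norm_integral_le_of_norm_le ((hru d m).const_mul _).integrableOn
            (Eventually.of_forall fun t => ?_)
          exact norm_apply_le (r m t - u t) x
      _ = 2 ^ d * ∫ t in J, jetNorm d p d (r m t - u t) := integral_const_mul _ _
      _ ≤ 2 ^ d * (1 / ((m : ℝ) + 1)) := by gcongr; exact hr' d m hm
  · have hle : ∀ᶠ m : ℕ in atTop, jetNorm d p k F ≤ (∫ t in J, jetNorm d p k (u t)) +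
        1 / ((m : ℝ) + 1) + jetNorm d p k (simpleIntegral (r m) J - F) := by
      filter_upwards [eventually_ge_atTop k] with m hm
      have h1 := map_sub_le_add (jetNorm d p k) (simpleIntegral (r m) J)
        (simpleIntegral (r m) J - F)
      rw [sub_sub_cancel] at h1
      have h2 := (jetNorm d p k).simpleIntegral_le (r m) hJ
      have h3 : ∫ t in J, jetNorm d p k (r m t) ≤
          ∫ t in J, (jetNorm d p k (u t) + jetNorm d p k (r m t - u t)) := by
        refine integral_mono_of_nonneg (Eventually.of_forall fun t => apply_nonneg _ _)
          ((u.integrable_jetNorm k).add (hru k m)).integrableOn (Eventually.of_forall fun t => ?_)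
        have := map_add_le_add (jetNorm d p k) (u t) (r m t - u t)
        rwa [add_sub_cancel] at this
      rw [integral_add (u.integrable_jetNorm k).integrableOn (hru k m).integrableOn] at h3
      linarith [hr' k m hm]
    refine ge_of_tendsto ?_ hle
    simpa only [add_zero] using (tendsto_const_nhds.add hzero).add (hF k)

end PreL1

/-! ### Primitives -/

/-- The set of all `s ∈ [0,1]` with `s ≤ a`, for a real number `a`. -/
def initialSegment (a : ℝ) : Set I := (fun s : I => (s : ℝ)) ⁻¹' Set.Iic a

/-- The set of all `s ∈ [0,1]` with `a < s ≤ b`, for real numbers `a`, `b`. -/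
def timeWindow (a b : ℝ) : Set I := (fun s : I => (s : ℝ)) ⁻¹' Set.Ioc a b

theorem measurableSet_initialSegment (a : ℝ) : MeasurableSet (initialSegment a) :=
  measurable_subtype_coe measurableSet_Iic

theorem measurableSet_timeWindow (a b : ℝ) : MeasurableSet (timeWindow a b) :=
  measurable_subtype_coe measurableSet_Ioc

section Primitive

variable {G : Type*} [NormedAddCommGroup G] [NormedSpace ℝ G]

theorem setIntegral_initialSegment_sub {g : I → G} (hg : Integrable g volume) {a b : ℝ}
    (hab : a ≤ b) : (∫ s in initialSegment b, g s) - ∫ s in initialSegment a, g s =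
      ∫ s in timeWindow a b, g s := by
  have h1 : initialSegment b = initialSegment a ∪ timeWindow a b := by
    rw [initialSegment, initialSegment, timeWindow, ← Set.preimage_union,
      Set.Iic_union_Ioc_eq_Iic hab]
  have h2 : Disjoint (initialSegment a) (timeWindow a b) := by
    refine Disjoint.preimage _ ?_
    rw [Set.disjoint_left]
    exact fun s hs hs' => absurd hs'.1 (not_lt.2 hs)
  rw [h1, setIntegral_union h2 (measurableSet_timeWindow a b) hg.integrableOn hg.integrableOn,
    add_sub_cancel_left]

theorem continuous_setIntegral_initialSegment {g : I → G} (hg : Integrable g volume) :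
    Continuous fun a : ℝ => ∫ s in initialSegment a, g s := by
  have h : (fun a : ℝ => ∫ s in initialSegment a, g s) =
      fun a => ∫ s, (initialSegment a).indicator g s :=
    funext fun a => (integral_indicator (measurableSet_initialSegment a)).symm
  rw [h, continuous_iff_continuousAt]
  intro a
  refine continuousAt_of_dominated (bound := fun s => ‖g s‖) ?_ ?_ hg.norm ?_
  · exact Eventually.of_forall fun b => hg.1.indicator (measurableSet_initialSegment b)
  · exact Eventually.of_forall fun b => Eventually.of_forall fun s =>
      norm_indicator_le_norm_self _ _
  · have hnull : ∀ᵐ s : I, (s : ℝ) ≠ a := by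
      by_cases ha : a ∈ I
      · filter_upwards [compl_mem_ae_iff.2 (measure_singleton (⟨a, ha⟩ : I))] with s hs h
        exact hs (Subtype.ext h)
      · exact Eventually.of_forall fun s h => ha (h ▸ s.2)
    filter_upwards [hnull] with s hs
    rcases lt_or_gt_of_ne hs with h | h
    · refine (continuousAt_const (y := g s)).congr ?_
      filter_upwards [lt_mem_nhds h] with b hb
      exact (Set.indicator_of_mem (show s ∈ initialSegment b from hb.le) g).symm
    · refine (continuousAt_const (y := (0 : G))).congr ?_
      filter_upwards [gt_mem_nhds h] with b hb
      exact (Set.indicator_of_notMem (show s ∉ initialSegment b from not_le.2 hb) g).symm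

theorem setIntegral_initialSegment_zero (g : I → G) : ∫ s in initialSegment 0, g s = 0 := by
  have h : initialSegment 0 = {(0 : I)} := by
    ext s
    refine ⟨fun hs => Subtype.ext (le_antisymm hs s.2.1), fun hs => ?_⟩
    rw [Set.mem_singleton_iff.1 hs]
    exact le_rfl (a := (0 : ℝ))
  rw [h]
  exact setIntegral_measure_zero _ (measure_singleton _)

end Primitive

namespace PreL1

open SobolevInf

variable {d : ℕ} {p : ℝ≥0∞} [Fact (1 ≤ p)]

/-- The primitive `a ↦ ∫_{s ≤ a} u s ds` of `u`, a curve in `W^{∞,p}`. -/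
noncomputable def primitive (u : PreL1 (SobolevInf d p)) (a : ℝ) : SobolevInf d p :=
  (u.exists_setIntegral (measurableSet_initialSegment a)).choose

/-- The integral of the norm of order `k` of `u` over all times `s ≤ a`. -/
noncomputable def mass (u : PreL1 (SobolevInf d p)) (k : ℕ) (a : ℝ) : ℝ :=
  ∫ s in initialSegment a, jetNorm d p k (u s)

/-- The `L¹` seminorm `∫₀¹ ‖u s‖ ds` for the norm of order `k`. -/
noncomputable def totalMass (u : PreL1 (SobolevInf d p)) (k : ℕ) : ℝ :=
  ∫ s, jetNorm d p k (u s)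

variable (u v : PreL1 (SobolevInf d p)) (k : ℕ)

theorem primitive_apply (a : ℝ) (x : Rd d) :
    u.primitive a x = ∫ s in initialSegment a, u s x :=
  (u.exists_setIntegral (measurableSet_initialSegment a)).choose_spec.1 x

theorem primitive_sub_apply {a b : ℝ} (hab : a ≤ b) (x : Rd d) :
    (u.primitive b - u.primitive a) x = ∫ s in timeWindow a b, u s x := by
  rw [SobolevInf.sub_apply, primitive_apply, primitive_apply,
    setIntegral_initialSegment_sub (u.integrable_apply continuous_const) hab]

theorem mass_sub {a b : ℝ} (hab : a ≤ b) :
    u.mass k b - u.mass k a = ∫ s in timeWindow a b, jetNorm d p k (u s) :=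
  setIntegral_initialSegment_sub (u.integrable_jetNorm k) hab

theorem mass_mono : Monotone (u.mass k) := fun a b hab => by
  have h := u.mass_sub k hab
  have : 0 ≤ ∫ s in timeWindow a b, jetNorm d p k (u s) :=
    integral_nonneg fun _ => apply_nonneg _ _
  linarith

theorem mass_nonneg (a : ℝ) : 0 ≤ u.mass k a := integral_nonneg fun _ => apply_nonneg _ _

theorem totalMass_nonneg : 0 ≤ u.totalMass k := integral_nonneg fun _ => apply_nonneg _ _

theorem mass_le_totalMass (a : ℝ) : u.mass k a ≤ u.totalMass k :=
  setIntegral_le_integral (u.integrable_jetNorm k) (Eventually.of_forall fun _ => apply_nonneg _ _)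

theorem continuous_mass : Continuous (u.mass k) :=
  continuous_setIntegral_initialSegment (u.integrable_jetNorm k)

theorem jetNorm_primitive_sub_le {a b : ℝ} (hab : a ≤ b) :
    jetNorm d p k (u.primitive b - u.primitive a) ≤ u.mass k b - u.mass k a := by
  obtain ⟨F, hF, hF'⟩ := u.exists_setIntegral (measurableSet_timeWindow a b)
  have : u.primitive b - u.primitive a = F :=
    SobolevInf.ext fun x => by rw [u.primitive_sub_apply hab, hF]
  rw [this, u.mass_sub k hab]
  exact hF' k

theorem primitive_sub (a : ℝ) : (u - v).primitive a = u.primitive a - v.primitive a :=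
  SobolevInf.ext fun x => by
    rw [SobolevInf.sub_apply, primitive_apply, primitive_apply, primitive_apply,
      ← integral_sub (u.integrable_apply continuous_const).integrableOn
        (v.integrable_apply continuous_const).integrableOn]
    rfl

theorem exists_abs_mass_sub_lt {ε : ℝ} (hε : 0 < ε) : ∃ η > 0, ∀ a ∈ I, ∀ b ∈ I,
    |a - b| < η → |u.mass k a - u.mass k b| < ε := by
  have h := isCompact_Icc.uniformContinuousOn_of_continuous
    (s := Set.Icc (0 : ℝ) 1) (u.continuous_mass k).continuousOn
  rw [Metric.uniformContinuousOn_iff] at h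
  exact h ε hε

/-! ### Euler approximations of the flow -/

/-- The increments of the primitive of `u` on the grid of mesh `1 / n`, stopped at time `t`. -/
noncomputable def increment (n : ℕ) (t : ℝ) (i : ℕ) : SobolevInf d p :=
  u.primitive (min t ((i + 1 : ℕ) / n)) - u.primitive (min t (i / n))

theorem min_div_mono (n : ℕ) (t : ℝ) : Monotone fun i : ℕ => min t ((i : ℝ) / n) :=
  fun i j hij => min_le_min_left _ (by gcongr)

theorem sum_mass_sub_le (f : ℕ → ℝ) (n : ℕ) :
    ∑ i ∈ Finset.range n, (u.mass k (f (i + 1)) - u.mass k (f i)) ≤ u.totalMass k := by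
  rw [Finset.sum_range_sub fun i => u.mass k (f i)]
  linarith [u.mass_nonneg k (f 0), u.mass_le_totalMass k (f n)]

theorem jetNorm_increment_le (n : ℕ) (t : ℝ) (i : ℕ) :
    jetNorm d p k (u.increment n t i) ≤
      u.mass k (min t ((i + 1 : ℕ) / n)) - u.mass k (min t (i / n)) :=
  u.jetNorm_primitive_sub_le k (min_div_mono n t (Nat.le_succ i))

theorem sum_jetNorm_increment_le (n : ℕ) (t : ℝ) (m : ℕ) :
    ∑ i ∈ Finset.range m, jetNorm d p k (u.increment n t i) ≤ u.totalMass k :=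
  (Finset.sum_le_sum fun i _ => u.jetNorm_increment_le k n t i).trans
    (u.sum_mass_sub_le k (fun i => min t ((i : ℝ) / n)) m)

theorem increment_sub (n : ℕ) (t : ℝ) (i : ℕ) :
    (u - v).increment n t i = u.increment n t i - v.increment n t i := by
  simp only [increment, primitive_sub]
  abel

theorem div_mul_block {n l : ℕ} (hl : 0 < l) (j : ℕ) :
    ((j * l : ℕ) : ℝ) / (n * l : ℕ) = j / n := by
  push_cast
  exact mul_div_mul_right _ _ (by positivity)

theorem sum_increment_block {n l : ℕ} (hl : 0 < l) (t : ℝ) (j : ℕ) :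
    ∑ r ∈ Finset.range l, u.increment (n * l) t (j * l + r) = u.increment n t j := by
  have h := Finset.sum_range_sub
    (fun r => u.primitive (min t ((j * l + r : ℕ) / (n * l : ℕ)))) l
  unfold increment
  refine h.trans ?_
  rw [add_zero, div_mul_block hl, show j * l + l = (j + 1) * l by ring, div_mul_block hl]

theorem sum_jetNorm_increment_block_le {n l : ℕ} (hl : 0 < l) (t : ℝ) (j : ℕ) :
    ∑ r ∈ Finset.range l, jetNorm d p k (u.increment (n * l) t (j * l + r)) ≤
      u.mass k (min t ((j + 1 : ℕ) / n)) - u.mass k (min t (j / n)) := by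
  have h := Finset.sum_range_sub
    (fun r => u.mass k (min t ((j * l + r : ℕ) / (n * l : ℕ)))) l
  rw [add_zero, div_mul_block hl, show j * l + l = (j + 1) * l by ring, div_mul_block hl] at h
  exact (Finset.sum_le_sum fun r _ => u.jetNorm_increment_le k _ t _).trans h.le

/-- The Euler approximation of the displacement of the flow at time `t`, with mesh `1 / n`. -/
noncomputable def eulerFlow (n : ℕ) (t : ℝ) : SobolevInf d p := euler (u.increment n t) n

theorem min_div_mem {t : ℝ} (ht : t ∈ I) (i n : ℕ) : min t ((i : ℝ) / n) ∈ I :=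
  ⟨le_min ht.1 (by positivity), (min_le_left _ _).trans ht.2⟩

theorem abs_min_div_sub_le {n : ℕ} (t : ℝ) (i : ℕ) :
    |min t ((i + 1 : ℕ) / n : ℝ) - min t ((i : ℝ) / n)| ≤ 1 / n := by
  refine (abs_min_sub_min_le_max _ _ _ _).trans ?_
  rw [sub_self, abs_zero, max_eq_right (abs_nonneg _), Nat.cast_succ, ← sub_div,
    add_sub_cancel_left, abs_of_nonneg (by positivity)]

theorem exists_jetNorm_eulerFlow_mul_sub_le {ε : ℝ} (hε : 0 < ε) : ∃ N : ℕ, ∀ n ≥ N, ∀ l > 0,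
    ∀ t ∈ I, jetNorm d p k (u.eulerFlow (n * l) t - u.eulerFlow n t) ≤ ε := by
  obtain ⟨C, hC0, hC⟩ := exists_jetNorm_euler_sub_euler_block_le (d := d) (p := p) k
    (u.totalMass_nonneg (k + 1 + d))
  obtain ⟨η, hη, hmod⟩ := u.exists_abs_mass_sub_lt (k + 1 + d)
    (show 0 < ε / (C + 1) by positivity)
  obtain ⟨N, hN⟩ := exists_nat_one_div_lt hη
  refine ⟨N + 1, fun n hn l hl t ht => ?_⟩
  have hn' : (1 : ℝ) / n < η := by
    refine lt_of_le_of_lt ?_ hN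
    have : ((N : ℝ) + 1) ≤ n := by exact_mod_cast hn
    gcongr
  have h := hC (u.increment (n * l) t) n l (ε / (C + 1)) (by positivity)
    (u.sum_jetNorm_increment_le _ _ _ _) (fun j hj => ?_)
  · have e : (fun j => ∑ r ∈ Finset.range l, u.increment (n * l) t (j * l + r)) =
        u.increment n t := funext fun j => u.sum_increment_block hl t j
    rw [e] at h
    refine h.trans ?_
    rw [mul_div_assoc', div_le_iff₀ (by positivity)]
    nlinarith
  · refine (u.sum_jetNorm_increment_block_le _ hl t j).trans ((le_abs_self _).trans ?_)
    exact (hmod _ (min_div_mem ht (j + 1) n) _ (min_div_mem ht j n)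
      ((abs_min_div_sub_le t j).trans_lt hn')).le

theorem exists_jetNorm_eulerFlow_sub_le {ε : ℝ} (hε : 0 < ε) : ∃ N : ℕ, ∀ m ≥ N, ∀ n ≥ N,
    ∀ t ∈ I, jetNorm d p k (u.eulerFlow m t - u.eulerFlow n t) ≤ ε := by
  obtain ⟨N, hN⟩ := u.exists_jetNorm_eulerFlow_mul_sub_le k (half_pos hε)
  refine ⟨N + 1, fun m hm n hn t ht => ?_⟩
  have h1 := hN m (by omega) n (by omega) t ht
  have h2 := hN n (by omega) m (by omega) t ht
  rw [mul_comm n m] at h2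
  have h3 := map_sub_le_add (jetNorm d p k) (u.eulerFlow (m * n) t - u.eulerFlow n t)
    (u.eulerFlow (m * n) t - u.eulerFlow m t)
  rw [sub_sub_sub_cancel_left] at h3
  linarith

theorem exists_tendsto_eulerFlow (t : I) : ∃ g : SobolevInf d p, ∀ k,
    Tendsto (fun n => jetNorm d p k (u.eulerFlow n t - g)) atTop (𝓝 0) :=
  exists_tendsto_of_cauchy _ fun k ε hε => by
    obtain ⟨N, hN⟩ := u.exists_jetNorm_eulerFlow_sub_le k hε
    exact ⟨N, fun m hm n hn => hN m hm n hn t t.2⟩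

/-- The displacement `φ_u(t)` of the flow of `u` at time `t`, as limit of Euler approximations. -/
noncomputable def flow (t : I) : SobolevInf d p := (u.exists_tendsto_eulerFlow t).choose

theorem tendsto_eulerFlow (t : I) :
    Tendsto (fun n => jetNorm d p k (u.eulerFlow n t - u.flow t)) atTop (𝓝 0) :=
  (u.exists_tendsto_eulerFlow t).choose_spec k

end PreL1

namespace SobolevInf

variable {d : ℕ} {p : ℝ≥0∞} [Fact (1 ≤ p)]

theorem jetNorm_sub_le_of_tendsto {k : ℕ} {f g : ℕ → SobolevInf d p} {F G : SobolevInf d p}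
    (hf : Tendsto (fun n => jetNorm d p k (f n - F)) atTop (𝓝 0))
    (hg : Tendsto (fun n => jetNorm d p k (g n - G)) atTop (𝓝 0)) {c : ℝ}
    (h : ∀ᶠ n in atTop, jetNorm d p k (f n - g n) ≤ c) : jetNorm d p k (F - G) ≤ c := by
  have h1 : ∀ᶠ n in atTop, jetNorm d p k (F - G) ≤
      c + jetNorm d p k (f n - F) + jetNorm d p k (g n - G) := by
    filter_upwards [h] with n hn
    have h2 := map_sub_le_add (jetNorm d p k) (f n - g n) ((f n - F) - (g n - G))
    have h3 := map_sub_le_add (jetNorm d p k) (f n - F) (g n - G)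
    rw [show f n - g n - ((f n - F) - (g n - G)) = F - G by abel] at h2
    linarith
  refine ge_of_tendsto ?_ h1
  simpa only [add_zero] using (tendsto_const_nhds.add hf).add hg

end SobolevInf

namespace PreL1

open SobolevInf

variable {d : ℕ} {p : ℝ≥0∞} [Fact (1 ≤ p)] (u v : PreL1 (SobolevInf d p)) (k : ℕ)

/-- The Euler approximations converge to the flow uniformly in time. -/
theorem exists_jetNorm_eulerFlow_sub_flow_le {ε : ℝ} (hε : 0 < ε) : ∃ N : ℕ, ∀ n ≥ N,
    ∀ t : I, jetNorm d p k (u.eulerFlow n t - u.flow t) ≤ ε := by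
  obtain ⟨N, hN⟩ := u.exists_jetNorm_eulerFlow_sub_le k hε
  refine ⟨N, fun n hn t => ?_⟩
  refine jetNorm_sub_le_of_tendsto (f := fun _ => u.eulerFlow n t) (by simp)
    (u.tendsto_eulerFlow k t) ?_
  filter_upwards [eventually_ge_atTop N] with m hm
  exact hN n hn m hm t t.2

/-- The flow is locally Lipschitz in the vector field, uniformly in time. -/
theorem exists_jetNorm_flow_sub_le {S : ℝ} (hS : 0 ≤ S) : ∃ C : ℝ, 0 ≤ C ∧
    ∀ u v : PreL1 (SobolevInf d p), u.totalMass (k + 1 + d) ≤ S → v.totalMass (k + 1 + d) ≤ S →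
    ∀ t : I, jetNorm d p k (u.flow t - v.flow t) ≤ C * (u - v).totalMass (k + 1 + d) := by
  obtain ⟨C, hC0, hC⟩ := exists_jetNorm_euler_sub_le (d := d) (p := p) k hS
  refine ⟨C, hC0, fun u v hu hv t => ?_⟩
  refine jetNorm_sub_le_of_tendsto (u.tendsto_eulerFlow k t) (v.tendsto_eulerFlow k t)
    (Eventually.of_forall fun n => ?_)
  refine (hC _ _ n ((u.sum_jetNorm_increment_le _ _ _ _).trans hu)
    ((v.sum_jetNorm_increment_le _ _ _ _).trans hv)).trans ?_
  gcongr
  simp only [← increment_sub]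
  exact (u - v).sum_jetNorm_increment_le _ _ _ _

theorem exists_jetNorm_flow_sub_flow_le : ∃ C : ℝ, 0 ≤ C ∧ ∀ s t : I, s ≤ t →
    jetNorm d p k (u.flow t - u.flow s) ≤
      C * (u.mass (k + 1 + d) t - u.mass (k + 1 + d) s) := by
  obtain ⟨C, hC0, hC⟩ := exists_jetNorm_euler_sub_le (d := d) (p := p) k
    (u.totalMass_nonneg (k + 1 + d))
  refine ⟨C, hC0, fun s t hst => ?_⟩
  have hst' : (s : ℝ) ≤ t := hst
  refine jetNorm_sub_le_of_tendsto (u.tendsto_eulerFlow k t) (u.tendsto_eulerFlow k s)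
    (Eventually.of_forall fun n => ?_)
  refine (hC _ _ n (u.sum_jetNorm_increment_le _ _ _ _)
    (u.sum_jetNorm_increment_le _ _ _ _)).trans ?_
  gcongr
  -- the difference of the increments is an increment on the grid clamped to `[s, t]`
  have hclamp : ∀ a : ℝ, u.primitive (min t a) - u.primitive (min s a) =
      u.primitive (max s (min t a)) - u.primitive s := by
    intro a
    rcases le_total a s with h | h
    · rw [min_eq_right h, min_eq_right (h.trans hst'), max_eq_left h, sub_self, sub_self]
    · rw [min_eq_left h, max_eq_right (le_min hst' h)]
  set c : ℕ → ℝ := fun i => max (s : ℝ) (min t ((i : ℝ) / n)) with hc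
  have hterm : ∀ i, u.increment n t i - u.increment n s i =
      u.primitive (c (i + 1)) - u.primitive (c i) := by
    intro i
    have h1 := hclamp ((i + 1 : ℕ) / n)
    have h2 := hclamp (i / n)
    calc u.increment n t i - u.increment n s i
        = (u.primitive (min t ((i + 1 : ℕ) / n)) - u.primitive (min s ((i + 1 : ℕ) / n))) -
          (u.primitive (min t (i / n)) - u.primitive (min s (i / n))) := by
          unfold increment; abel
      _ = _ := by rw [h1, h2]; exact sub_sub_sub_cancel_right _ _ _
  have hcm : Monotone c := fun i j hij => max_le_max_left _ (min_div_mono n t hij)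
  calc ∑ i ∈ Finset.range n, jetNorm d p (k + 1 + d) (u.increment n t i - u.increment n s i)
      ≤ ∑ i ∈ Finset.range n, (u.mass (k + 1 + d) (c (i + 1)) - u.mass (k + 1 + d) (c i)) :=
        Finset.sum_le_sum fun i _ => by
          rw [hterm]
          exact u.jetNorm_primitive_sub_le _ (hcm (Nat.le_succ i))
    _ = u.mass (k + 1 + d) (c n) - u.mass (k + 1 + d) (c 0) :=
        Finset.sum_range_sub (fun i => u.mass (k + 1 + d) (c i)) n
    _ ≤ _ := sub_le_sub (u.mass_mono _ (max_le hst' (min_le_left _ _)))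
        (u.mass_mono _ (le_max_left _ _))

theorem continuous_flow : Continuous u.flow := by
  rw [continuous_iff_continuousAt]
  intro t
  refine (withSeminorms.tendsto_nhds _ _).2 fun k ε hε => ?_
  obtain ⟨C, hC0, hC⟩ := u.exists_jetNorm_flow_sub_flow_le k
  have hcont : Tendsto (fun s : I => C * |u.mass (k + 1 + d) s - u.mass (k + 1 + d) t|)
      (𝓝 t) (𝓝 0) := by
    have h : Continuous fun s : I => C * |u.mass (k + 1 + d) s - u.mass (k + 1 + d) t| :=
      continuous_const.mul
        (((u.continuous_mass _).comp continuous_subtype_val).sub continuous_const).abs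
    simpa using h.tendsto t
  filter_upwards [hcont.eventually_lt_const hε] with s hs
  refine ((seminorm_le_jetNorm le_rfl _).trans ?_).trans_lt hs
  rcases le_total s t with h | h
  · rw [map_sub_rev]
    refine (hC s t h).trans ?_
    gcongr
    rw [abs_sub_comm]
    exact le_abs_self _
  · refine (hC t s h).trans ?_
    gcongr
    exact le_abs_self _

end PreL1

/-! ### The flow solves the integral equation -/

namespace SobolevInf

variable {d : ℕ} {p : ℝ≥0∞} [Fact (1 ≤ p)]

theorem euler_congr {f g : ℕ → SobolevInf d p} {n : ℕ} (h : ∀ i < n, f i = g i) :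
    euler f n = euler g n := by
  induction n with
  | zero => rfl
  | succ n ih => rw [euler_succ, euler_succ, ih fun i hi => h i (by omega), h n (by omega)]

theorem euler_eq_of_forall_ge {f : ℕ → SobolevInf d p} {i n : ℕ} (hin : i ≤ n)
    (h : ∀ j ≥ i, f j = 0) : euler f n = euler f i := by
  induction n, hin using Nat.le_induction with
  | base => rfl
  | succ n hn ih => rw [euler_succ, h n hn, zero_comp, add_zero, ih]

end SobolevInf

namespace PreL1

open SobolevInf

variable {d : ℕ} {p : ℝ≥0∞} [Fact (1 ≤ p)] (u : PreL1 (SobolevInf d p))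

/-- Intermediate values of the Euler scheme are Euler approximations for earlier times. -/
theorem euler_increment_eq_eulerFlow {n i : ℕ} (hi : i ≤ n) (t : ℝ) :
    euler (u.increment n t) i = u.eulerFlow n (min t (i / n)) := by
  have h1 : ∀ j ≥ i, u.increment n (min t (i / n)) j = 0 := by
    intro j hj
    have e : ∀ l : ℕ, i ≤ l → min (min (t : ℝ) ((i : ℝ) / n)) ((l : ℝ) / n) = min t (i / n) := by
      intro l hl
      refine min_eq_left ((min_le_right _ _).trans ?_)
      gcongr
    unfold increment
    rw [e j hj, e (j + 1) (by omega), sub_self]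
  rw [eulerFlow, euler_eq_of_forall_ge hi h1]
  refine euler_congr fun j hj => ?_
  have e : ∀ l : ℕ, l ≤ i → min (min (t : ℝ) ((i : ℝ) / n)) ((l : ℝ) / n) = min t (l / n) := by
    intro l hl
    rw [min_assoc, min_eq_right (a := (i : ℝ) / n)]
    gcongr
  unfold increment
  rw [e j hj.le, e (j + 1) hj]

theorem norm_primitive_sub_apply_sub_le {y : I → Rd d} (hy : Continuous y) {a b : ℝ}
    (hab : a ≤ b) (w : Rd d) {ρ : ℝ} (hρ : ∀ s ∈ timeWindow a b, ‖w - y s‖ ≤ ρ) :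
    ‖(u.primitive b - u.primitive a) w - ∫ s in timeWindow a b, u s (y s)‖ ≤
      2 ^ d * (u.mass (1 + d) b - u.mass (1 + d) a) * ρ := by
  rw [u.primitive_sub_apply hab, ← integral_sub
    (u.integrable_apply continuous_const).integrableOn (u.integrable_apply hy).integrableOn,
    u.mass_sub _ hab, ← integral_const_mul, ← integral_mul_const]
  refine norm_integral_le_of_norm_le
    (((u.integrable_jetNorm _).const_mul _).mul_const _).integrableOn ?_
  filter_upwards [ae_restrict_mem (measurableSet_timeWindow a b)] with s hs
  refine (norm_sub_apply_le (u s) w (y s)).trans ?_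
  gcongr
  exact hρ s hs

/-- If the Euler approximations follow a continuous curve `y` up to errors which are controlled by
the distance to the integral `x + ∫ u s (y s) ds` and a small number, then they converge to this
integral. -/
theorem add_flow_eq_of_forall_norm_sub_le {x : Rd d} {y : I → Rd d} (hy : Continuous y) (t : I)
    (h : ∀ ε > 0, ∃ N : ℕ, ∀ n : ℕ, n ≥ N → ∀ i : ℕ, i < n →
      ∀ s ∈ timeWindow (min (t : ℝ) ((i : ℝ) / n)) (min (t : ℝ) (((i + 1 : ℕ) : ℝ) / n)),
      ‖x + u.eulerFlow n (min (t : ℝ) ((i : ℝ) / n)) x - y s‖ ≤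
        ‖x + u.eulerFlow n (min (t : ℝ) ((i : ℝ) / n)) x -
          (x + ∫ s in initialSegment (min (t : ℝ) ((i : ℝ) / n)), u s (y s))‖ + ε) :
    x + u.flow t x = x + ∫ s in Set.Iic t, u s (y s) := by
  have hseg : Set.Iic t = initialSegment t := rfl
  rw [hseg]
  set W : ℝ → Rd d := fun a => x + ∫ s in initialSegment a, u s (y s) with hW
  set T := u.totalMass (1 + d) with hT
  have hT0 : 0 ≤ T := u.totalMass_nonneg _
  have hflow := u.tendsto_eulerFlow d t
  have key : ∀ ε > 0, ∃ N : ℕ, ∀ n : ℕ, n ≥ N →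
      ‖x + u.eulerFlow n t x - W t‖ ≤ 2 ^ d * T * Real.exp (2 ^ d * T) * ε := by
    intro ε hε
    obtain ⟨N, hN⟩ := h ε hε
    refine ⟨N + 1, fun n hn => ?_⟩
    have hn0 : (0 : ℝ) < n := by exact_mod_cast (by omega : 0 < n)
    set M : ℕ → ℝ := fun i => u.mass (1 + d) (min (t : ℝ) ((i : ℝ) / n)) with hM
    have hMm : ∀ i, 0 ≤ M (i + 1) - M i := fun i =>
      sub_nonneg.2 (u.mass_mono _ (min_div_mono n t (Nat.le_succ i)))
    have hMT : ∑ i ∈ Finset.range n, (M (i + 1) - M i) ≤ T :=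
      u.sum_mass_sub_le (1 + d) (fun i => min (t : ℝ) ((i : ℝ) / n)) n
    have hg := discrete_gronwall_range
      (u := fun i => ‖x + euler (u.increment n t) i x - W (min (t : ℝ) ((i : ℝ) / n))‖)
      (b := fun i => 2 ^ d * (M (i + 1) - M i) * ε) (c := fun i => 2 ^ d * (M (i + 1) - M i))
      (n := n) (norm_nonneg _) (fun i => by have := hMm i; positivity)
      (fun i => by have := hMm i; positivity) (fun i hi => ?_)
    · have h0 : x + euler (u.increment n t) 0 x - W (min t (((0 : ℕ) : ℝ) / n)) = 0 := by
        have e : min (t : ℝ) (((0 : ℕ) : ℝ) / n) = 0 := by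
          rw [Nat.cast_zero, zero_div]; exact min_eq_right t.2.1
        rw [e, hW]
        simp only [setIntegral_initialSegment_zero]
        exact sub_self _
      have hend : min (t : ℝ) ((n : ℝ) / n) = t := by
        rw [div_self hn0.ne']; exact min_eq_left t.2.2
      simp only [h0, norm_zero, zero_add, hend, ← Finset.mul_sum, ← Finset.sum_mul] at hg
      refine hg.trans ?_
      calc _ ≤ 2 ^ d * T * ε * Real.exp (2 ^ d * T) := by gcongr
        _ = _ := by ring
    · have hab : min (t : ℝ) ((i : ℝ) / n) ≤ min (t : ℝ) (((i + 1 : ℕ) : ℝ) / n) :=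
        min_div_mono n t (Nat.le_succ i)
      have hstep := u.norm_primitive_sub_apply_sub_le hy hab
        (x + euler (u.increment n t) i x)
        (ρ := ‖x + euler (u.increment n t) i x - W (min (t : ℝ) ((i : ℝ) / n))‖ + ε) (by
          rw [u.euler_increment_eq_eulerFlow hi.le]
          exact hN n (by omega) i hi)
      rw [← setIntegral_initialSegment_sub (u.integrable_apply hy) hab] at hstep
      have e : x + euler (u.increment n t) (i + 1) x - W (min (t : ℝ) (((i + 1 : ℕ) : ℝ) / n)) =
          (x + euler (u.increment n t) i x - W (min (t : ℝ) ((i : ℝ) / n))) +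
          (u.increment n t i (x + euler (u.increment n t) i x) -
            ((∫ s in initialSegment (min (t : ℝ) (((i + 1 : ℕ) : ℝ) / n)), u s (y s)) -
              ∫ s in initialSegment (min (t : ℝ) ((i : ℝ) / n)), u s (y s))) := by
        have habel : ∀ a b c e : Rd d, x + (a + b) - (x + c) = (x + a - (x + e)) + (b - (c - e)) :=
          fun a b c e => by abel
        exact habel _ _ _ _
      rw [e]
      refine (norm_add_le _ _).trans ((add_le_add_right hstep _).trans (le_of_eq ?_))
      simp only [hM]
      ring
  have hx : Tendsto (fun n => x + u.eulerFlow n t x) atTop (𝓝 (x + u.flow t x)) := by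
    refine tendsto_const_nhds.add ?_
    rw [tendsto_iff_norm_sub_tendsto_zero]
    refine squeeze_zero (fun _ => norm_nonneg _)
      (fun n => norm_apply_le (u.eulerFlow n t - u.flow t) x) ?_
    simpa only [mul_zero] using hflow.const_mul ((2 : ℝ) ^ d)
  refine tendsto_nhds_unique hx ?_
  rw [Metric.tendsto_atTop]
  intro ε hε
  have hC : 0 ≤ 2 ^ d * T * Real.exp (2 ^ d * T) := by positivity
  obtain ⟨N, hN⟩ := key (ε / (2 ^ d * T * Real.exp (2 ^ d * T) + 1)) (by positivity)
  refine ⟨N, fun n hn => ?_⟩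
  rw [dist_eq_norm]
  refine (hN n hn).trans_lt ?_
  rw [mul_div_assoc', div_lt_iff₀ (by positivity)]
  nlinarith

theorem exists_norm_sub_lt_of_mem_timeWindow {y : I → Rd d} (hy : Continuous y) (t : I) {ε : ℝ}
    (hε : 0 < ε) : ∃ N : ℕ, ∀ n ≥ N, ∀ i : ℕ,
      ∀ s ∈ timeWindow (min (t : ℝ) ((i : ℝ) / n)) (min (t : ℝ) (((i + 1 : ℕ) : ℝ) / n)),
      ‖y ⟨min (t : ℝ) ((i : ℝ) / n), min_div_mem t.2 i n⟩ - y s‖ < ε := by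
  obtain ⟨η, hη, h⟩ := Metric.uniformContinuous_iff.1
    (CompactSpace.uniformContinuous_of_continuous hy) ε hε
  obtain ⟨N, hN⟩ := exists_nat_one_div_lt hη
  refine ⟨N + 1, fun n hn i s hs => ?_⟩
  rw [← dist_eq_norm]
  refine h ?_
  have hn' : (1 : ℝ) / n < η := by
    refine lt_of_le_of_lt ?_ hN
    have : ((N : ℝ) + 1) ≤ n := by exact_mod_cast hn
    gcongr
  have h1 := (le_abs_self _).trans (abs_min_div_sub_le (n := n) (t : ℝ) i)
  have h2 : min (t : ℝ) ((i : ℝ) / n) < s := hs.1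
  have h3 : (s : ℝ) ≤ min (t : ℝ) (((i + 1 : ℕ) : ℝ) / n) := hs.2
  rw [Subtype.dist_eq, Real.dist_eq, abs_sub_comm, abs_of_nonneg (by simpa using h2.le)]
  change (s : ℝ) - min (t : ℝ) ((i : ℝ) / n) < η
  linarith

theorem continuous_add_flow_apply (x : Rd d) : Continuous fun t => x + u.flow t x := by
  refine continuous_const.add (continuous_iff_continuousAt.2 fun t => ?_)
  have h := ((continuous_jetNorm (p := p) d).tendsto 0).comp
    (show Tendsto (fun s => u.flow s - u.flow t) (𝓝 t) (𝓝 0) by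
      have := withSeminorms (d := d) (p := p) |>.topologicalAddGroup
      simpa using (u.continuous_flow.tendsto t).sub_const (u.flow t))
  rw [map_zero] at h
  rw [ContinuousAt, tendsto_iff_norm_sub_tendsto_zero]
  refine squeeze_zero (fun _ => norm_nonneg _)
    (fun s => norm_apply_le (u.flow s - u.flow t) x) ?_
  simpa only [mul_zero, Function.comp_apply] using h.const_mul ((2 : ℝ) ^ d)

theorem isIntegralSolution_flow (x : Rd d) :
    IsIntegralSolution (fun s => u s) x fun t => x + u.flow t x := by
  have hy := u.continuous_add_flow_apply x
  refine ⟨hy, u.integrable_apply hy, fun t => ?_⟩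
  refine u.add_flow_eq_of_forall_norm_sub_le hy t fun ε hε => ?_
  obtain ⟨N, hN⟩ := exists_norm_sub_lt_of_mem_timeWindow hy t (half_pos hε)
  obtain ⟨N', hN'⟩ := u.exists_jetNorm_eulerFlow_sub_flow_le d
    (show 0 < ε / 2 / 2 ^ d by positivity)
  refine ⟨max N N', fun n hn i _ s hs => ?_⟩
  refine le_add_of_nonneg_of_le (norm_nonneg _) ?_
  have h1 := hN n (le_of_max_le_left hn) i s hs
  have h2 := hN' n (le_of_max_le_right hn) ⟨min (t : ℝ) ((i : ℝ) / n), min_div_mem t.2 i n⟩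
  have h3 := norm_apply_le (u.eulerFlow n (min (t : ℝ) ((i : ℝ) / n)) -
    u.flow ⟨min (t : ℝ) ((i : ℝ) / n), min_div_mem t.2 i n⟩) x
  have h4 : 2 ^ d * jetNorm d p d (u.eulerFlow n (min (t : ℝ) ((i : ℝ) / n)) -
      u.flow ⟨min (t : ℝ) ((i : ℝ) / n), min_div_mem t.2 i n⟩) ≤ ε / 2 := by
    calc _ ≤ 2 ^ d * (ε / 2 / 2 ^ d) := by gcongr
      _ = ε / 2 := by field_simp
  have h5 := norm_add_le ((u.eulerFlow n (min (t : ℝ) ((i : ℝ) / n)) -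
    u.flow ⟨min (t : ℝ) ((i : ℝ) / n), min_div_mem t.2 i n⟩) x)
    (x + u.flow ⟨min (t : ℝ) ((i : ℝ) / n), min_div_mem t.2 i n⟩ x - (x + u.flow s x))
  rw [SobolevInf.sub_apply] at h5 h3
  rw [show x + u.eulerFlow n (min (t : ℝ) ((i : ℝ) / n)) x - (x + u.flow s x) =
    u.eulerFlow n (min (t : ℝ) ((i : ℝ) / n)) x -
      u.flow ⟨min (t : ℝ) ((i : ℝ) / n), min_div_mem t.2 i n⟩ x +
    (x + u.flow ⟨min (t : ℝ) ((i : ℝ) / n), min_div_mem t.2 i n⟩ x - (x + u.flow s x)) by abel]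
  linarith

theorem eq_flow_of_isIntegralSolution {x : Rd d} {y : I → Rd d}
    (h : IsIntegralSolution (fun s => u s) x y) : y = fun t => x + u.flow t x := by
  obtain ⟨hy, -, hint⟩ := h
  funext t
  rw [hint t]
  refine (u.add_flow_eq_of_forall_norm_sub_le hy t fun ε hε => ?_).symm
  obtain ⟨N, hN⟩ := exists_norm_sub_lt_of_mem_timeWindow hy t hε
  refine ⟨N, fun n hn i _ s hs => ?_⟩
  have h1 := hN n hn i s hs
  have h2 : y ⟨min (t : ℝ) ((i : ℝ) / n), min_div_mem t.2 i n⟩ =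
      x + ∫ s in initialSegment (min (t : ℝ) ((i : ℝ) / n)), u s (y s) := hint _
  rw [h2] at h1
  refine (norm_sub_le_norm_sub_add_norm_sub _
    (x + ∫ s in initialSegment (min (t : ℝ) ((i : ℝ) / n)), u s (y s)) _).trans ?_
  gcongr

theorem isIntegralSolution_iff {x : Rd d} {y : I → Rd d} :
    IsIntegralSolution (fun s => u s) x y ↔ y = fun t => x + u.flow t x :=
  ⟨u.eq_flow_of_isIntegralSolution, fun h => h ▸ u.isIntegralSolution_flow x⟩

/-! ### Continuous dependence on the vector field -/

theorem withSeminorms (E : Type*) [AddCommGroup E] [Module ℝ E] [TopologicalSpace E] :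
    WithSeminorms (PreL1.seminorm :
      SeminormFamily ℝ (PreL1 E) {q : Seminorm ℝ E // Continuous q}) := ⟨rfl⟩

theorem tendsto_totalMass_sub (k : ℕ) :
    Tendsto (fun v : PreL1 (SobolevInf d p) => (v - u).totalMass k) (𝓝 u) (𝓝 0) := by
  have h := (PreL1.withSeminorms (SobolevInf d p)).continuous_seminorm
    ⟨jetNorm d p k, continuous_jetNorm k⟩
  have := (PreL1.withSeminorms (SobolevInf d p)).topologicalAddGroup
  have h2 := (h.comp (continuous_id.sub (continuous_const (y := u)))).tendsto u
  simpa using! h2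

/-- Vector fields with the same class have the same flow. -/
theorem flow_eq_of_sub_mem_nullFunctions {u v : PreL1 (SobolevInf d p)}
    (h : u - v ∈ nullFunctions (SobolevInf d p)) (t : I) : u.flow t = v.flow t := by
  obtain ⟨C, -, hC⟩ := exists_jetNorm_flow_sub_le (d := d) (p := p) d
    ((u.totalMass_nonneg (d + 1 + d)).trans (le_max_left _ (v.totalMass (d + 1 + d))))
  have h1 := hC u v (le_max_left _ _) (le_max_right _ _) t
  have h2 : (u - v).totalMass (d + 1 + d) = 0 := h ⟨_, continuous_jetNorm _⟩
  rw [h2, mul_zero] at h1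
  refine SobolevInf.ext fun x => ?_
  have h3 := norm_apply_le (u.flow t - v.flow t) x
  rw [SobolevInf.sub_apply] at h3
  have h4 : (2 : ℝ) ^ d * jetNorm d p d (u.flow t - v.flow t) ≤ 0 :=
    mul_nonpos_of_nonneg_of_nonpos (by positivity) h1
  exact sub_eq_zero.1 (norm_le_zero_iff.1 (h3.trans h4))

theorem continuous_uncurry_flow :
    Continuous fun z : PreL1 (SobolevInf d p) × I => z.1.flow z.2 := by
  rw [continuous_iff_continuousAt]
  rintro ⟨u, t⟩
  refine (SobolevInf.withSeminorms.tendsto_nhds _ _).2 fun k ε hε => ?_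
  obtain ⟨C, hC0, hC⟩ := exists_jetNorm_flow_sub_le (d := d) (p := p) k
    (show 0 ≤ u.totalMass (k + 1 + d) + 1 by
      linarith [u.totalMass_nonneg (k + 1 + d)])
  have h1 : Tendsto (fun z : PreL1 (SobolevInf d p) × I => (z.1 - u).totalMass (k + 1 + d))
      (𝓝 (u, t)) (𝓝 0) := (u.tendsto_totalMass_sub _).comp continuous_fst.continuousAt
  have h2 : Tendsto (fun z : PreL1 (SobolevInf d p) × I => u.flow z.2) (𝓝 (u, t))
      (𝓝 (u.flow t)) := (u.continuous_flow.tendsto t).comp continuous_snd.continuousAt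
  have h3 := (SobolevInf.withSeminorms.tendsto_nhds _ _).1 h2 k (ε / 2) (half_pos hε)
  have h4 : Tendsto (fun z : PreL1 (SobolevInf d p) × I =>
      C * (z.1 - u).totalMass (k + 1 + d)) (𝓝 (u, t)) (𝓝 0) := by
    simpa only [mul_zero] using h1.const_mul C
  filter_upwards [h3, h1.eventually_lt_const one_pos, h4.eventually_lt_const (half_pos hε)]
    with z hz3 hz1 hz4
  have hz : z.1.totalMass (k + 1 + d) ≤ u.totalMass (k + 1 + d) + 1 := by
    have := map_add_le_add (PreL1.seminorm (E := SobolevInf d p)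
      ⟨jetNorm d p (k + 1 + d), continuous_jetNorm _⟩) u (z.1 - u)
    rw [add_sub_cancel] at this
    have : z.1.totalMass (k + 1 + d) ≤
      u.totalMass (k + 1 + d) + (z.1 - u).totalMass (k + 1 + d) := this
    linarith
  have h5 := (seminorm_le_jetNorm le_rfl _).trans (hC z.1 u hz (by linarith) z.2)
  have h6 := map_add_le_add (SobolevInf.seminorm d p k) (z.1.flow z.2 - u.flow z.2)
    (u.flow z.2 - u.flow t)
  rw [sub_add_sub_cancel] at h6
  linarith

end PreL1

theorem theorem5p3 (d : ℕ) (p : ℝ≥0∞) [Fact (1 ≤ p)] :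
    ∃ φ : SeminormL1 (SobolevInf d p) → C(I, SobolevInf d p),
      (∀ (u : PreL1 (SobolevInf d p)) (x : Rd d) (y : I → Rd d),
        IsIntegralSolution (fun s => u s) x y ↔
          y = fun t => x + φ (Submodule.Quotient.mk u) t x) ∧
      Continuous φ := by
  have hwd : ∀ u v : PreL1 (SobolevInf d p),
      (nullFunctions (SobolevInf d p)).quotientRel u v →
      (⟨u.flow, u.continuous_flow⟩ : C(I, SobolevInf d p)) = ⟨v.flow, v.continuous_flow⟩ :=
    fun u v h => ContinuousMap.ext fun t => PreL1.flow_eq_of_sub_mem_nullFunctions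
      ((Submodule.quotientRel_def _).1 h) t
  refine ⟨Quotient.lift (fun u => ⟨u.flow, u.continuous_flow⟩) hwd, fun u x y => ?_, ?_⟩
  · exact u.isIntegralSolution_iff
  · refine Continuous.quotient_lift ?_ hwd
    exact ContinuousMap.continuous_of_continuous_uncurry _ PreL1.continuous_uncurry_flow
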